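/- Let $d\ge 0$ be an integer, let $S^d=\{x\in\mathbb{R}^{d+1}:\|x\|=1\}$ with surface measure $d\omega$, and let $\kappa,\tau\in\mathbb{R}^{d+1}$ with $\kappa_j\ge 0$ and $\tau_j>-\tfrac12$ for all $1\le j\le d+1$. Put $h_\tau(x)=\prod_{j=1}^{d+1}|x_j|^{\tau_j}$, $\operatorname{meas}_\tau E=\int_E h_\tau^2\,d\omega$, and let $\|f\|_{\tau,p}$ be the norm of $L^p(h_\tau^2;S^d)=L^p(S^d,h_\tau^2\,d\omega)$; define $h_\kappa$ in the same way. Let $$V_\kappa g(x)=c_\kappa\int_{[-1,1]^{d+1}}g(x_1t_1,\dots,x_{d+1}t_{d+1})\prod_{i=1}^{d+1}(1+t_i)(1-t_i^2)^{\kappa_i-1}\,dt ,$$ where $c_\kappa$ is determined by $V_\kappa 1=1$; if $\kappa_i=0$, the normalized measure in the variable $t_i$ is replaced by its limit as $\kappa_i\to0^+$, the unit mass at $t_i=1$. For $x\in S^d$ let $B(x,\theta)=\{y\in\mathbb{R}^{d+1}:\|y\|\le1,\ \langle x,y\rangle\ge\cos\theta\}$ and $$\mathcal{M}_\kappa f(x)=\sup_{0<\theta\le\pi}\frac{\int_{S^d}|f(y)|\,V_\kappa[\chi_{B(x,\theta)}](y)\,h_\kappa^2(y)\,d\omega(y)}{\int_{S^d}V_\kappa[\chi_{B(x,\theta)}](y)\,h_\kappa^2(y)\,d\omega(y)}\in[0,\infty].$$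 (i) If $\tau_j\le\kappa_j$ for all $j$, there is a constant $c$, depending only on $d,\kappa,\tau$, such that for all $f\in L^1(h_\tau^2;S^d)$ and all $\alpha>0$, $$\operatorname{meas}_\tau\{x\in S^d:\mathcal{M}_\kappa f(x)\ge\alpha\}\le c\,\frac{\|f\|_{\tau,1}}{\alpha}.$$ (ii) If $1<p\le\infty$ and $\tau_j<p\kappa_j+\frac{p-1}{2}$ for all $j$ (no condition if $p=\infty$), there is a constant $c$, depending only on $d,\kappa,\tau,p$, such that for all $f\in L^p(h_\tau^2;S^d)$ the function $\mathcal{M}_\kappa f$ is measurable with respect to the completion of $h_\tau^2\,d\omega$ and $$\|\mathcal{M}_\kappa f\|_{\tau,p}\le c\,\|f\|_{\tau,p}.$$ (iii) For $p=\infty$ the estimate also holds on $C(S^d)$ with the uniform norm: there is a constant $c$, depending only on $d,\kappa,\tau$, with $\sup_{x\in S^d}\mathcal{M}_\kappa f(x)\le c\,\sup_{x\in S^d}|f(x)|$ for every continuous $f$ on $S^d$. -/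

import Mathlib

open MeasureTheory
open scoped ENNReal NNReal

noncomputable section

namespace SphereMaximal

/-- The Euclidean space `ℝ^{d+1}`. -/
abbrev E (d : ℕ) : Type := EuclideanSpace ℝ (Fin (d + 1))

/-- The unit sphere `S^d` of `ℝ^{d+1}`. -/
abbrev S (d : ℕ) : Type := Metric.sphere (0 : E d) 1

/-- The surface (Lebesgue) measure `dω` on `S^d`. -/
def surface (d : ℕ) : Measure (S d) := (volume : Measure (E d)).toSphere

/-- The product weight `h_τ(x) = ∏ⱼ |xⱼ|^{τⱼ}`. -/
def weight {d : ℕ} (τ : Fin (d + 1) → ℝ) (x : E d) : ℝ := ∏ j, |x j| ^ τ j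

/-- The measure `h_τ² dω` on `S^d`; its value on a set `A` is `meas_τ A`. -/
def weightedMeasure {d : ℕ} (τ : Fin (d + 1) → ℝ) : Measure (S d) :=
  (surface d).withDensity fun x => ENNReal.ofReal (weight τ (x : E d) ^ 2)

/-- The measure `(1 + t) (1 - t²)^{k-1} dt` on `[-1,1]`, before normalization. -/
def rawMeasure (k : ℝ) : Measure ℝ :=
  (volume.restrict (Set.Icc (-1 : ℝ) 1)).withDensity
    fun t => ENNReal.ofReal ((1 + t) * (1 - t ^ 2) ^ (k - 1))

/-- One factor of the measure that represents the intertwining operator of `ℤ₂^{d+1}`: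
for `k > 0` the probability measure proportional to `(1 + t) (1 - t²)^{k-1} dt` on `[-1,1]`;
for `k = 0` its weak limit as `k → 0+`, the unit mass at `1`. -/
def factorMeasure (k : ℝ) : Measure ℝ :=
  if k = 0 then Measure.dirac 1 else (rawMeasure k Set.univ)⁻¹ • rawMeasure k

/-- The intertwining operator `V_κ` of the group `ℤ₂^{d+1}`,
`V_κ g(x) = c_κ ∫_{[-1,1]^{d+1}} g(x₁t₁, …, x_{d+1}t_{d+1}) ∏ᵢ (1 + tᵢ) (1 - tᵢ²)^{κᵢ-1} dt`. -/
def V {d : ℕ} (κ : Fin (d + 1) → ℝ) (g : E d → ℝ) (x : E d) : ℝ :=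
  ∫ t, g (WithLp.toLp 2 fun i => x i * t i) ∂(Measure.pi fun i => factorMeasure (κ i))

/-- The solid cap `B(x,θ) = {y : ‖y‖ ≤ 1, ⟨x,y⟩ ≥ cos θ}`. -/
def solidCap {d : ℕ} (x : E d) (θ : ℝ) : Set (E d) :=
  {y | ‖y‖ ≤ 1 ∧ Real.cos θ ≤ inner ℝ x y}

/-- `V_κ[χ_{B(x,θ)}](y)`. -/
def kernel {d : ℕ} (κ : Fin (d + 1) → ℝ) (x : E d) (θ : ℝ) (y : E d) : ℝ :=
  V κ ((solidCap x θ).indicator fun _ => 1) y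

/-- The maximal function `𝓜_κ f`, with values in `[0,∞]`: the supremum over `0 < θ ≤ π` of
`∫ |f| V_κ[χ_{B(x,θ)}] h_κ² dω / ∫ V_κ[χ_{B(x,θ)}] h_κ² dω`. -/
def maximal {d : ℕ} (κ : Fin (d + 1) → ℝ) (f : S d → ℝ) (x : S d) : ℝ≥0∞ :=
  ⨆ θ ∈ Set.Ioc (0 : ℝ) Real.pi,
    (∫⁻ y, ‖f y‖ₑ * ENNReal.ofReal (kernel κ (x : E d) θ (y : E d)) ∂(weightedMeasure κ)) /
      (∫⁻ y, ENNReal.ofReal (kernel κ (x : E d) θ (y : E d)) ∂(weightedMeasure κ))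

end SphereMaximal

end

/-!
Up to constants, `V_κ[χ_{B(x,θ)}]` lies below an explicit number `decay κ x θ` times the indicator
of the set `absBall x θ` of points `y` with `||y_j| - |x_j|| ≤ θ` for all `j`, and above
`decay κ x θ` on a part of that set of comparable `h_κ²`-measure, the measure in question being
`θ^d ∏ (|x_j| + θ)^{2κ_j}`. Hence `M_κ f` is dominated by the Hardy–Littlewood maximal function of
`h_κ² dω` along the balls of the coordinates `|x_j|`, and for every `τ` with `τ_j > -1/2` the
corresponding maximal function of `h_τ² dω` has weak type `(1,1)` by Vitali's covering lemma and
strong type `(s,s)`, `s > 1`, by interpolation with `L^∞`.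

It remains to change the weight. For `τ_j ≤ κ_j` the quotient `h_κ² / h_τ²` is increasing in each
`|y_j|`, so averages for `κ` are at most a constant times averages for `τ`. If
`τ_j < p κ_j + (p - 1)/2`, the same inequality holds with some `1 < q < p` in place of `p`;
Hölder's inequality with exponent `q` and the dual weight `σ_j = (q κ_j - τ_j)/(q - 1) > -1/2`
bounds the average of `g` for `κ` by a constant times the `q`-th root of the average of `g ^ q`
for `τ`, and the maximal function for `τ` is applied in `L^{p/q}`.
-/

noncomputable section

namespace SphereMaximal

/-! ### Integrals of powers on the line -/

theorem rpow_le_mul_rpow_of_le_mul {a b K : ℝ} (e : ℝ) (ha : 0 < a) (hb : 0 < b) (hK : 0 < K)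
    (hab : a ≤ K * b) (hba : b ≤ K * a) : b ^ e ≤ K ^ |e| * a ^ e := by
  rcases le_total 0 e with he | he
  · rw [abs_of_nonneg he, ← Real.mul_rpow hK.le ha.le]
    exact Real.rpow_le_rpow hb.le hba he
  · rw [abs_of_nonpos he, Real.rpow_neg hK.le, ← Real.inv_rpow hK.le,
      ← Real.mul_rpow (by positivity) ha.le]
    exact Real.rpow_le_rpow_of_nonpos (by positivity) ((inv_mul_le_iff₀ hK).2 hab) he

theorem lintegral_rpow_Ioc {e b : ℝ} (he : -1 < e) (hb : 0 ≤ b) :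
    ∫⁻ s in Set.Ioc 0 b, ENNReal.ofReal (s ^ e) = ENNReal.ofReal (b ^ (e + 1) / (e + 1)) := by
  have hint : IntegrableOn (fun s : ℝ => s ^ e) (Set.Ioc 0 b) :=
    (intervalIntegrable_iff_integrableOn_Ioc_of_le hb).1
      (intervalIntegral.intervalIntegrable_rpow' he)
  have hnonneg : 0 ≤ᵐ[volume.restrict (Set.Ioc 0 b)] fun s : ℝ => s ^ e := by
    filter_upwards [ae_restrict_mem measurableSet_Ioc] with s hs
    exact Real.rpow_nonneg hs.1.le _
  rw [← ofReal_integral_eq_lintegral_ofReal hint hnonneg, ← intervalIntegral.integral_of_le hb,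
    integral_rpow (Or.inl he), Real.zero_rpow (by linarith), sub_zero]

theorem lintegral_one_sub_rpow_Ico {e δ : ℝ} (he : -1 < e) (hδ : 0 ≤ δ) :
    ∫⁻ t in Set.Ico (1 - δ) 1, ENNReal.ofReal ((1 - t) ^ e) =
      ENNReal.ofReal (δ ^ (e + 1) / (e + 1)) := by
  rw [← lintegral_rpow_Ioc he hδ,
    ← ((volume : Measure ℝ).measurePreserving_sub_left 1).setLIntegral_comp_preimage_emb
      (MeasurableEquiv.subLeft (1 : ℝ)).measurableEmbedding
      (fun s => ENNReal.ofReal (s ^ e)) (Set.Ioc 0 δ)]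
  simp

theorem lintegral_abs_rpow_Icc_le {e b : ℝ} (he : -1 < e) (hb : 0 ≤ b) :
    ∫⁻ s in Set.Icc (-b) b, ENNReal.ofReal (|s| ^ e) ≤
      ENNReal.ofReal (2 * (b ^ (e + 1) / (e + 1))) := by
  have hpos : ∫⁻ s in Set.Icc 0 b, ENNReal.ofReal (|s| ^ e) =
      ENNReal.ofReal (b ^ (e + 1) / (e + 1)) := by
    rw [← lintegral_rpow_Ioc he hb, Measure.restrict_congr_set Ioc_ae_eq_Icc.symm]
    exact setLIntegral_congr_fun measurableSet_Ioc fun s hs => by simp only [abs_of_pos hs.1]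
  have hneg : ∫⁻ s in Set.Icc (-b) 0, ENNReal.ofReal (|s| ^ e) =
      ENNReal.ofReal (b ^ (e + 1) / (e + 1)) := by
    rw [← hpos, ← (Measure.measurePreserving_neg
      (volume : Measure ℝ)).setLIntegral_comp_preimage_emb
      (MeasurableEquiv.neg ℝ).measurableEmbedding
      (fun s => ENNReal.ofReal (|s| ^ e)) (Set.Icc 0 b)]
    simp
  have hnonneg : 0 ≤ b ^ (e + 1) / (e + 1) := div_nonneg (Real.rpow_nonneg hb _) (by linarith)
  calc ∫⁻ s in Set.Icc (-b) b, ENNReal.ofReal (|s| ^ e)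
      = ∫⁻ s in Set.Icc (-b) 0 ∪ Set.Icc 0 b, ENNReal.ofReal (|s| ^ e) := by
        rw [Set.Icc_union_Icc_eq_Icc (by linarith) hb]
    _ ≤ _ := lintegral_union_le _ _ _
    _ = ENNReal.ofReal (2 * (b ^ (e + 1) / (e + 1))) := by
        rw [hpos, hneg, two_mul, ENNReal.ofReal_add hnonneg hnonneg]

theorem lintegral_abs_preimage_closedBall_rpow_le_of_lt {e u θ : ℝ} (he : -1 < e) (hu : 0 ≤ u)
    (hθ : 0 < θ) (hlt : u < 2 * θ) :
    ∫⁻ s in abs ⁻¹' Metric.closedBall u θ, ENNReal.ofReal (|s| ^ e) ≤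
      ENNReal.ofReal (2 * 3 ^ (e + 1) / (e + 1) * 3 ^ |e| * (θ * (u + θ) ^ e)) := by
  have he1 : 0 < e + 1 := by linarith
  have hsub : abs ⁻¹' Metric.closedBall u θ ⊆ Set.Icc (-(3 * θ)) (3 * θ) := by
    intro s hs
    rw [Set.mem_preimage, Metric.mem_closedBall, Real.dist_eq, abs_le] at hs
    rw [Set.mem_Icc, ← abs_le]
    linarith
  have hcomp : θ ^ e ≤ 3 ^ |e| * (u + θ) ^ e :=
    rpow_le_mul_rpow_of_le_mul e (by positivity) hθ (by norm_num) (by linarith) (by linarith)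
  refine (lintegral_mono_set hsub).trans
    ((lintegral_abs_rpow_Icc_le he (by positivity)).trans (ENNReal.ofReal_le_ofReal ?_))
  calc 2 * ((3 * θ) ^ (e + 1) / (e + 1))
      = 2 * 3 ^ (e + 1) / (e + 1) * θ * θ ^ e := by
        rw [Real.mul_rpow (by norm_num) hθ.le, Real.rpow_add_one hθ.ne']; ring
    _ ≤ 2 * 3 ^ (e + 1) / (e + 1) * θ * (3 ^ |e| * (u + θ) ^ e) := by gcongr
    _ = 2 * 3 ^ (e + 1) / (e + 1) * 3 ^ |e| * (θ * (u + θ) ^ e) := by ring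

theorem volume_abs_preimage_closedBall_le (u : ℝ) {θ : ℝ} (hθ : 0 ≤ θ) :
    volume (abs ⁻¹' Metric.closedBall u θ) ≤ ENNReal.ofReal (4 * θ) := by
  have hsub : abs ⁻¹' Metric.closedBall u θ ⊆
      Metric.closedBall u θ ∪ Metric.closedBall (-u) θ := by
    intro s hs
    rw [Set.mem_preimage, Metric.mem_closedBall, Real.dist_eq] at hs
    rcases abs_choice s with h | h <;> rw [h] at hs
    · exact Or.inl hs
    · right
      rwa [Metric.mem_closedBall, Real.dist_eq, ← abs_neg, show -(s - -u) = -s - u by ring]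
  calc volume (abs ⁻¹' Metric.closedBall u θ)
      ≤ volume (Metric.closedBall u θ) + volume (Metric.closedBall (-u) θ) :=
        (measure_mono hsub).trans (measure_union_le _ _)
    _ = ENNReal.ofReal (4 * θ) := by
        rw [Real.volume_closedBall, Real.volume_closedBall,
          ← ENNReal.ofReal_add (by positivity) (by positivity)]
        congr 1; ring

theorem lintegral_abs_preimage_closedBall_rpow_le_of_le {e u θ : ℝ} (hθ : 0 < θ)
    (hle : 2 * θ ≤ u) :
    ∫⁻ s in abs ⁻¹' Metric.closedBall u θ, ENNReal.ofReal (|s| ^ e) ≤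
      ENNReal.ofReal (4 * 3 ^ |e| * (θ * (u + θ) ^ e)) := by
  have hbound : ∀ s ∈ abs ⁻¹' Metric.closedBall u θ,
      ENNReal.ofReal (|s| ^ e) ≤ ENNReal.ofReal (3 ^ |e| * (u + θ) ^ e) := by
    intro s hs
    rw [Set.mem_preimage, Metric.mem_closedBall, Real.dist_eq, abs_le] at hs
    refine ENNReal.ofReal_le_ofReal (rpow_le_mul_rpow_of_le_mul e (by linarith)
      (by linarith) (by norm_num) ?_ ?_) <;> linarith
  calc ∫⁻ s in abs ⁻¹' Metric.closedBall u θ, ENNReal.ofReal (|s| ^ e)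
      ≤ ∫⁻ _ in abs ⁻¹' Metric.closedBall u θ, ENNReal.ofReal (3 ^ |e| * (u + θ) ^ e) :=
        setLIntegral_mono' (measurable_norm Metric.isClosed_closedBall.measurableSet) hbound
    _ ≤ ENNReal.ofReal (3 ^ |e| * (u + θ) ^ e) * ENNReal.ofReal (4 * θ) := by
        rw [setLIntegral_const]
        gcongr
        exact volume_abs_preimage_closedBall_le u hθ.le
    _ = ENNReal.ofReal (4 * 3 ^ |e| * (θ * (u + θ) ^ e)) := by
        rw [← ENNReal.ofReal_mul (by have := hθ.le.trans (by linarith : θ ≤ u); positivity)]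
        congr 1; ring

theorem exists_lintegral_abs_preimage_closedBall_rpow_le {e : ℝ} (he : -1 < e) :
    ∃ C : ℝ, 0 < C ∧ ∀ u θ : ℝ, 0 ≤ u → 0 < θ →
      ∫⁻ s in abs ⁻¹' Metric.closedBall u θ, ENNReal.ofReal (|s| ^ e) ≤
        ENNReal.ofReal (C * (θ * (u + θ) ^ e)) := by
  have he1 : 0 < e + 1 := by linarith
  refine ⟨max (2 * 3 ^ (e + 1) / (e + 1) * 3 ^ |e|) (4 * 3 ^ |e|), by positivity,
    fun u θ hu hθ => ?_⟩
  rcases lt_or_ge u (2 * θ) with h | h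
  · refine (lintegral_abs_preimage_closedBall_rpow_le_of_lt he hu hθ h).trans ?_
    gcongr
    exact le_max_left _ _
  · refine (lintegral_abs_preimage_closedBall_rpow_le_of_le hθ h).trans ?_
    gcongr
    exact le_max_right _ _

/-! ### The one-dimensional factors of `V_κ` -/

section Factor

variable {k δ : ℝ}

theorem one_add_mul_one_sub_sq_rpow {t : ℝ} (ht : t ∈ Set.Ioo (-1 : ℝ) 1) :
    (1 + t) * (1 - t ^ 2) ^ (k - 1) = (1 + t) ^ k * (1 - t) ^ (k - 1) := by
  have hpos : 0 < 1 + t := by linarith [ht.1]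
  rw [show 1 - t ^ 2 = (1 + t) * (1 - t) by ring, Real.mul_rpow hpos.le (by linarith [ht.2]),
    Real.rpow_sub_one hpos.ne']
  field_simp

theorem rawMeasure_apply (k : ℝ) {A : Set ℝ} (hA : MeasurableSet A) :
    rawMeasure k A = ∫⁻ t in A ∩ Set.Ioo (-1 : ℝ) 1,
      ENNReal.ofReal ((1 + t) ^ k * (1 - t) ^ (k - 1)) := by
  have hae : (A ∩ Set.Icc (-1 : ℝ) 1 : Set ℝ) =ᵐ[volume] (A ∩ Set.Ioo (-1 : ℝ) 1 : Set ℝ) :=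
    Filter.EventuallyEq.rfl.inter Ioo_ae_eq_Icc.symm
  rw [rawMeasure, withDensity_apply _ hA, Measure.restrict_restrict hA,
    Measure.restrict_congr_set hae]
  refine setLIntegral_congr_fun (hA.inter measurableSet_Ioo) fun t ht => ?_
  simp only [one_add_mul_one_sub_sq_rpow ht.2]

theorem le_rawMeasure_Ici (hk : 0 < k) (hδ : 0 ≤ δ) (hδ1 : δ ≤ 1) :
    ENNReal.ofReal (δ ^ k / k) ≤ rawMeasure k (Set.Ici (1 - δ)) := by
  have hsub : Set.Ico (1 - δ) 1 ⊆ Set.Ici (1 - δ) ∩ Set.Ioo (-1 : ℝ) 1 :=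
    fun t ht => ⟨ht.1, by linarith [ht.1], ht.2⟩
  have hint := lintegral_one_sub_rpow_Ico (e := k - 1) (by linarith) hδ
  rw [sub_add_cancel] at hint
  rw [rawMeasure_apply k measurableSet_Ici, ← hint]
  refine le_trans ?_ (lintegral_mono_set hsub)
  refine setLIntegral_mono' measurableSet_Ico fun t ht => ENNReal.ofReal_le_ofReal ?_
  have hone : 1 ≤ (1 + t) ^ k := Real.one_le_rpow (by linarith [ht.1]) hk.le
  exact le_mul_of_one_le_left (Real.rpow_nonneg (by linarith [ht.2]) _) hone

theorem rawMeasure_Ici_le (hk : 0 < k) (hδ : 0 ≤ δ) :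
    rawMeasure k (Set.Ici (1 - δ)) ≤ ENNReal.ofReal (2 ^ k / k * δ ^ k) := by
  have hsub : Set.Ici (1 - δ) ∩ Set.Ioo (-1 : ℝ) 1 ⊆ Set.Ico (1 - δ) 1 :=
    fun t ht => ⟨ht.1, ht.2.2⟩
  have hint := lintegral_one_sub_rpow_Ico (e := k - 1) (by linarith) hδ
  rw [sub_add_cancel] at hint
  rw [rawMeasure_apply k measurableSet_Ici, div_mul_eq_mul_div, mul_div_assoc,
    ENNReal.ofReal_mul (by positivity), ← hint, ← lintegral_const_mul' _ _ ENNReal.ofReal_ne_top]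
  refine le_trans ?_ (lintegral_mono_set hsub)
  refine setLIntegral_mono' (measurableSet_Ici.inter measurableSet_Ioo) fun t ht => ?_
  rw [← ENNReal.ofReal_mul (by positivity)]
  have hle : (1 + t) ^ k ≤ 2 ^ k :=
    Real.rpow_le_rpow (by linarith [ht.2.1]) (by linarith [ht.2.2]) hk.le
  exact ENNReal.ofReal_le_ofReal
    (mul_le_mul_of_nonneg_right hle (Real.rpow_nonneg (by linarith [ht.2.2]) _))

theorem rawMeasure_Iic_le (hk : 0 < k) (hδ : δ ≤ 1) :
    rawMeasure k (Set.Iic (δ - 1)) ≤ ENNReal.ofReal (2 ^ k * δ ^ k) := by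
  have hbound : ∀ t ∈ Set.Iic (δ - 1) ∩ Set.Ioo (-1 : ℝ) 1,
      ENNReal.ofReal ((1 + t) ^ k * (1 - t) ^ (k - 1)) ≤ ENNReal.ofReal (2 ^ k * δ ^ k) := by
    rintro t ⟨ht : t ≤ δ - 1, ht1, _⟩
    have hleft : (1 + t) ^ k ≤ δ ^ k := Real.rpow_le_rpow (by linarith) (by linarith) hk.le
    have hright : (1 - t) ^ (k - 1) ≤ 2 ^ k := by
      calc (1 - t) ^ (k - 1) ≤ (1 - t) ^ k :=
            Real.rpow_le_rpow_of_exponent_le (by linarith) (by linarith)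
        _ ≤ 2 ^ k := Real.rpow_le_rpow (by linarith) (by linarith) hk.le
    rw [mul_comm]
    exact ENNReal.ofReal_le_ofReal
      (mul_le_mul hright hleft (Real.rpow_nonneg (by linarith) _) (by positivity))
  have hvol : volume (Set.Iic (δ - 1) ∩ Set.Ioo (-1 : ℝ) 1) ≤ 1 := by
    calc volume (Set.Iic (δ - 1) ∩ Set.Ioo (-1 : ℝ) 1) ≤ volume (Set.Icc (-1 : ℝ) 0) :=
          measure_mono fun t ht => ⟨ht.2.1.le, by linarith [show t ≤ δ - 1 from ht.1]⟩
      _ = 1 := by simp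
  rw [rawMeasure_apply k measurableSet_Iic]
  calc _ ≤ _ := setLIntegral_mono' (measurableSet_Iic.inter measurableSet_Ioo) hbound
    _ = _ := setLIntegral_const _ _
    _ ≤ _ := mul_le_of_le_one_right' hvol

theorem rawMeasure_one_sub_le_abs_le (hk : 0 < k) (hδ : 0 ≤ δ) (hδ1 : δ ≤ 1) :
    rawMeasure k {t | 1 - δ ≤ |t|} ≤ ENNReal.ofReal ((2 ^ k / k + 2 ^ k) * δ ^ k) := by
  have hsub : {t : ℝ | 1 - δ ≤ |t|} ⊆ Set.Ici (1 - δ) ∪ Set.Iic (δ - 1) := by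
    intro t (ht : 1 - δ ≤ |t|)
    rcases le_abs.1 ht with h | h
    · exact Or.inl h
    · exact Or.inr (by rw [Set.mem_Iic]; linarith)
  calc rawMeasure k {t | 1 - δ ≤ |t|}
      ≤ rawMeasure k (Set.Ici (1 - δ)) + rawMeasure k (Set.Iic (δ - 1)) :=
        (measure_mono hsub).trans (measure_union_le _ _)
    _ ≤ ENNReal.ofReal (2 ^ k / k * δ ^ k) + ENNReal.ofReal (2 ^ k * δ ^ k) :=
        add_le_add (rawMeasure_Ici_le hk hδ) (rawMeasure_Iic_le hk hδ1)
    _ = ENNReal.ofReal ((2 ^ k / k + 2 ^ k) * δ ^ k) := by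
        rw [← ENNReal.ofReal_add (by positivity) (by positivity), add_mul]

theorem rawMeasure_univ_ne_zero (hk : 0 < k) : rawMeasure k Set.univ ≠ 0 := by
  have hle := (le_rawMeasure_Ici hk zero_le_one le_rfl).trans (measure_mono (Set.subset_univ _))
  refine (lt_of_lt_of_le ?_ hle).ne'
  rw [ENNReal.ofReal_pos]
  positivity

theorem rawMeasure_univ_ne_top (hk : 0 < k) : rawMeasure k Set.univ ≠ ∞ := by
  have huniv : {t : ℝ | 1 - 1 ≤ |t|} = Set.univ := by simp
  rw [← huniv]
  exact ne_top_of_le_ne_top ENNReal.ofReal_ne_top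
    (rawMeasure_one_sub_le_abs_le hk zero_le_one le_rfl)

theorem factorMeasure_apply_of_pos (hk : 0 < k) (A : Set ℝ) :
    factorMeasure k A = (rawMeasure k Set.univ)⁻¹ * rawMeasure k A := by
  rw [factorMeasure, if_neg hk.ne', Measure.smul_apply, smul_eq_mul]

theorem isProbabilityMeasure_factorMeasure (hk : 0 ≤ k) :
    IsProbabilityMeasure (factorMeasure k) := by
  rcases hk.eq_or_lt with rfl | hk
  · rw [factorMeasure, if_pos rfl]
    infer_instance
  · exact ⟨by rw [factorMeasure_apply_of_pos hk, ENNReal.inv_mul_cancel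
      (rawMeasure_univ_ne_zero hk) (rawMeasure_univ_ne_top hk)]⟩

theorem ae_factorMeasure_abs_le_one (k : ℝ) : ∀ᵐ t ∂(factorMeasure k), |t| ≤ 1 := by
  simp only [abs_le]
  rw [factorMeasure]
  split_ifs with h
  · exact (ae_dirac_iff measurableSet_Icc).2 (by norm_num)
  · exact Measure.ae_smul_measure ((withDensity_absolutelyContinuous _ _).ae_le
      (ae_restrict_mem measurableSet_Icc)) _

theorem ofReal_inv_toReal_rawMeasure_univ (hk : 0 < k) :
    ENNReal.ofReal (rawMeasure k Set.univ).toReal⁻¹ = (rawMeasure k Set.univ)⁻¹ := by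
  rw [ENNReal.ofReal_inv_of_pos (ENNReal.toReal_pos (rawMeasure_univ_ne_zero hk)
    (rawMeasure_univ_ne_top hk)), ENNReal.ofReal_toReal (rawMeasure_univ_ne_top hk)]

theorem exists_le_factorMeasure_Ici (hk : 0 ≤ k) :
    ∃ c : ℝ, 0 < c ∧ ∀ δ : ℝ, 0 ≤ δ → δ ≤ 1 →
      ENNReal.ofReal (c * δ ^ k) ≤ factorMeasure k (Set.Ici (1 - δ)) := by
  rcases hk.eq_or_lt with rfl | hk
  · refine ⟨1, one_pos, fun δ hδ _ => ?_⟩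
    rw [factorMeasure, if_pos rfl, Measure.dirac_apply' _ measurableSet_Ici]
    simp [hδ]
  · have hmass : 0 < (rawMeasure k Set.univ).toReal :=
      ENNReal.toReal_pos (rawMeasure_univ_ne_zero hk) (rawMeasure_univ_ne_top hk)
    refine ⟨(rawMeasure k Set.univ).toReal⁻¹ / k, by positivity, fun δ hδ hδ1 => ?_⟩
    rw [factorMeasure_apply_of_pos hk, div_mul_eq_mul_div, mul_div_assoc,
      ENNReal.ofReal_mul (by positivity), ofReal_inv_toReal_rawMeasure_univ hk]
    gcongr
    exact le_rawMeasure_Ici hk hδ hδ1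

theorem exists_factorMeasure_one_sub_le_abs_le (hk : 0 ≤ k) :
    ∃ C : ℝ, 1 ≤ C ∧ ∀ δ : ℝ, 0 ≤ δ →
      factorMeasure k {t | 1 - δ ≤ |t|} ≤ ENNReal.ofReal (C * δ ^ k) := by
  have := isProbabilityMeasure_factorMeasure hk
  rcases hk.eq_or_lt with rfl | hk
  · exact ⟨1, le_rfl, fun δ _ => by simp [prob_le_one]⟩
  set R := (rawMeasure k Set.univ).toReal
  refine ⟨max 1 (R⁻¹ * (2 ^ k / k + 2 ^ k)), le_max_left _ _, fun δ hδ => ?_⟩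
  rcases le_or_gt δ 1 with hδ1 | hδ1
  · calc factorMeasure k {t | 1 - δ ≤ |t|}
        ≤ ENNReal.ofReal R⁻¹ * ENNReal.ofReal ((2 ^ k / k + 2 ^ k) * δ ^ k) := by
          rw [factorMeasure_apply_of_pos hk, ofReal_inv_toReal_rawMeasure_univ hk]
          gcongr
          exact rawMeasure_one_sub_le_abs_le hk hδ hδ1
      _ = ENNReal.ofReal (R⁻¹ * (2 ^ k / k + 2 ^ k) * δ ^ k) := by
          rw [← ENNReal.ofReal_mul (by positivity), mul_assoc]
      _ ≤ ENNReal.ofReal (max 1 (R⁻¹ * (2 ^ k / k + 2 ^ k)) * δ ^ k) := by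
          gcongr
          exact le_max_right _ _
  · refine prob_le_one.trans (ENNReal.one_le_ofReal.2 ?_)
    exact one_le_mul_of_one_le_of_one_le (le_max_left _ _) (Real.one_le_rpow hδ1.le hk.le)

theorem one_sub_sq_le_abs_of_abs_sub_le {u v θ t : ℝ} (hθ : 0 < θ) (huv : |(|u| - |v|)| ≤ θ)
    (ht : |u * v| - u * v * t ≤ θ ^ 2 / 2) : 1 - (3 * (θ / (|u| + θ))) ^ 2 ≤ |t| := by
  have hu := abs_nonneg u
  rcases lt_or_ge |u| (2 * θ) with hlt | hge
  · have hone : 1 ≤ 3 * (θ / (|u| + θ)) := by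
      rw [← mul_div_assoc, le_div_iff₀ (by positivity)]
      linarith
    linarith [one_le_pow₀ hone (n := 2), abs_nonneg t]
  · have hv : |u| / 2 ≤ |v| := by linarith [(abs_le.1 huv).2]
    have hu0 : 0 < |u| := by linarith
    have hprod : 0 < |u * v| := by rw [abs_mul]; exact mul_pos hu0 (by linarith)
    have hsize : θ ^ 2 / 2 ≤ |u * v| * (3 * (θ / (|u| + θ))) ^ 2 := by
      have hsq : (|u| + θ) ^ 2 ≤ 18 * (|u| * |v|) := by nlinarith
      rw [abs_mul, ← mul_div_assoc, div_pow, ← mul_div_assoc, le_div_iff₀ (by positivity)]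
      nlinarith [mul_le_mul_of_nonneg_left hsq (sq_nonneg θ)]
    have hlin : u * v * t ≤ |u * v| * |t| := (le_abs_self _).trans (abs_mul _ _).le
    refine le_of_mul_le_mul_left ?_ hprod
    linarith

theorem exists_factorMeasure_abs_sub_le_le (hk : 0 ≤ k) :
    ∃ C : ℝ, 0 < C ∧ ∀ u v θ : ℝ, 0 < θ → |(|u| - |v|)| ≤ θ →
      factorMeasure k {t | |u * v| - u * v * t ≤ θ ^ 2 / 2} ≤
        ENNReal.ofReal (C * (θ / (|u| + θ)) ^ (2 * k)) := by
  obtain ⟨C, hC1, hC⟩ := exists_factorMeasure_one_sub_le_abs_le hk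
  refine ⟨C * 3 ^ (2 * k), by positivity, fun u v θ hθ huv => ?_⟩
  calc factorMeasure k {t | |u * v| - u * v * t ≤ θ ^ 2 / 2}
      ≤ factorMeasure k {t | 1 - (3 * (θ / (|u| + θ))) ^ 2 ≤ |t|} :=
        measure_mono fun t ht => one_sub_sq_le_abs_of_abs_sub_le hθ huv ht
    _ ≤ ENNReal.ofReal (C * ((3 * (θ / (|u| + θ))) ^ 2) ^ k) := hC _ (sq_nonneg _)
    _ = ENNReal.ofReal (C * 3 ^ (2 * k) * (θ / (|u| + θ)) ^ (2 * k)) := by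
        rw [← Real.rpow_two, ← Real.rpow_mul (by positivity),
          Real.mul_rpow (by norm_num) (by positivity), mul_assoc]

end Factor

/-! ### From truncated weak type to strong type -/

section MeasureSpace

variable {X : Type*} [MeasurableSpace X] {μ : Measure X}

theorem mul_measure_le_of_forall_mul_measure_lt_le {F : X → ℝ≥0∞} {N : ℝ≥0∞}
    (h : ∀ l : ℝ≥0∞, l * μ {x | l < F x} ≤ N) (l : ℝ≥0∞) : l * μ {x | l ≤ F x} ≤ N :=
  ENNReal.mul_le_of_forall_lt fun l' hl' m hm => calc
    l' * m ≤ l' * μ {x | l' < F x} := by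
      gcongr
      exact hm.le.trans (measure_mono fun x hx => hl'.trans_le hx)
    _ ≤ N := h l'

theorem lintegral_Ioo_rpow_sub_one {s r : ℝ} (hs : 0 < s) (hr : 0 ≤ r) :
    ∫⁻ t in Set.Ioo (0 : ℝ) r, ENNReal.ofReal (t ^ (s - 1)) =
      ENNReal.ofReal r ^ s / ENNReal.ofReal s := by
  rw [Measure.restrict_congr_set Ioo_ae_eq_Ioc, lintegral_rpow_Ioc (by linarith) hr,
    sub_add_cancel, ENNReal.ofReal_div_of_pos hs, ENNReal.ofReal_rpow_of_nonneg hr hs.le]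

theorem lintegral_Ioi_rpow_sub_one_eq_top {s : ℝ} (hs : 0 < s) :
    ∫⁻ t in Set.Ioi (0 : ℝ), ENNReal.ofReal (t ^ (s - 1)) = ∞ := by
  refine ENNReal.eq_top_of_forall_nnreal_le fun N => ?_
  set r : ℝ := ((N : ℝ) * s) ^ s⁻¹ with hr
  have hr0 : 0 ≤ r := by positivity
  calc (N : ℝ≥0∞) = ENNReal.ofReal r ^ s / ENNReal.ofReal s := by
        rw [ENNReal.ofReal_rpow_of_nonneg hr0 hs.le, hr, Real.rpow_inv_rpow (by positivity) hs.ne',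
          ← ENNReal.ofReal_div_of_pos hs, mul_div_cancel_right₀ _ hs.ne',
          ENNReal.ofReal_coe_nnreal]
    _ = ∫⁻ t in Set.Ioo (0 : ℝ) r, ENNReal.ofReal (t ^ (s - 1)) :=
        (lintegral_Ioo_rpow_sub_one hs hr0).symm
    _ ≤ _ := lintegral_mono_set fun t ht => ht.1

theorem rpow_eq_lintegral_indicator {s : ℝ} (hs : 0 < s) (a : ℝ≥0∞) :
    a ^ s = ENNReal.ofReal s * ∫⁻ t in Set.Ioi (0 : ℝ),
      {t : ℝ | ENNReal.ofReal t < a}.indicator (fun t => ENNReal.ofReal (t ^ (s - 1))) t := by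
  have hs0 : ENNReal.ofReal s ≠ 0 := by simpa using hs
  have hmeas : MeasurableSet {t : ℝ | ENNReal.ofReal t < a} :=
    measurableSet_lt (by fun_prop) (by fun_prop)
  rw [lintegral_indicator hmeas, Measure.restrict_restrict hmeas]
  rcases eq_or_ne a ∞ with rfl | ha
  · simp only [ENNReal.ofReal_lt_top, Set.ofPred_true, Set.univ_inter]
    rw [lintegral_Ioi_rpow_sub_one_eq_top hs, ENNReal.top_rpow_of_pos hs, ENNReal.mul_top hs0]
  · have hset : {t : ℝ | ENNReal.ofReal t < a} ∩ Set.Ioi 0 = Set.Ioo 0 a.toReal := by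
      ext t
      rw [Set.inter_comm]
      exact and_congr_right fun ht => ENNReal.ofReal_lt_iff_lt_toReal (le_of_lt ht) ha
    rw [hset, lintegral_Ioo_rpow_sub_one hs ENNReal.toReal_nonneg, ENNReal.ofReal_toReal ha,
      ENNReal.mul_div_cancel hs0 ENNReal.ofReal_ne_top]

theorem lintegral_rpow_eq_lintegral_measure_lt [SFinite μ] {F : X → ℝ≥0∞} (hF : Measurable F)
    {s : ℝ} (hs : 0 < s) :
    ∫⁻ x, F x ^ s ∂μ = ENNReal.ofReal s *
      ∫⁻ t in Set.Ioi (0 : ℝ), ENNReal.ofReal (t ^ (s - 1)) * μ {x | ENNReal.ofReal t < F x} := by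
  have hjoint : Measurable (Function.uncurry fun (x : X) (t : ℝ) =>
      {t : ℝ | ENNReal.ofReal t < F x}.indicator (fun t => ENNReal.ofReal (t ^ (s - 1))) t) :=
    Measurable.indicator (f := fun p : X × ℝ => ENNReal.ofReal (p.2 ^ (s - 1)))
      (s := {p : X × ℝ | ENNReal.ofReal p.2 < F p.1}) (by fun_prop)
      (measurableSet_lt (by fun_prop) (by fun_prop))
  simp only [rpow_eq_lintegral_indicator hs]
  rw [lintegral_const_mul' _ _ ENNReal.ofReal_ne_top,
    lintegral_lintegral_swap hjoint.aemeasurable]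
  congr 1
  refine lintegral_congr fun t => ?_
  rw [← lintegral_indicator_const (measurableSet_lt (by fun_prop) hF)]
  rfl

theorem rpow_eq_mul_rpow_sub_one (a : ℝ≥0∞) {s : ℝ} (hs : 1 ≤ s) :
    a ^ s = a * a ^ (s - 1) := by
  conv_rhs => rw [← ENNReal.rpow_one a, ← ENNReal.rpow_mul, one_mul]
  rw [← ENNReal.rpow_add_of_nonneg _ _ zero_le_one (by linarith), add_sub_cancel]

theorem lintegral_rpow_le_of_measurable_of_truncated_weakType [SFinite μ] {F g : X → ℝ≥0∞}
    (hF : Measurable F) (hg : Measurable g) {s : ℝ} (hs : 1 < s) {B : ℝ≥0}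
    (h : ∀ l : ℝ≥0∞, l * μ {x | l < F x} ≤ B * ∫⁻ x in {x | l < B * g x}, g x ∂μ) :
    ∫⁻ x, F x ^ s ∂μ ≤
      ENNReal.ofReal s / ENNReal.ofReal (s - 1) * B ^ s * ∫⁻ x, g x ^ s ∂μ := by
  have hs1 : 0 < s - 1 := by linarith
  have hslice : ∀ t ∈ Set.Ioi (0 : ℝ),
      ENNReal.ofReal (t ^ (s - 1)) * μ {x | ENNReal.ofReal t < F x} ≤
        B * (ENNReal.ofReal (t ^ (s - 1 - 1)) *
          μ.withDensity g {x | ENNReal.ofReal t < B * g x}) := by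
    intro t ht
    rw [withDensity_apply _ (measurableSet_lt (by fun_prop) (by fun_prop)), mul_left_comm,
      ← sub_add_cancel (s - 1) 1, add_sub_cancel_right, Real.rpow_add_one (ne_of_gt ht),
      ENNReal.ofReal_mul (Real.rpow_nonneg (le_of_lt ht) _), mul_assoc]
    exact mul_le_mul_right (h _) _
  calc ∫⁻ x, F x ^ s ∂μ
      ≤ ENNReal.ofReal s * ∫⁻ t in Set.Ioi (0 : ℝ), B * (ENNReal.ofReal (t ^ (s - 1 - 1)) *
          μ.withDensity g {x | ENNReal.ofReal t < B * g x}) := by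
        rw [lintegral_rpow_eq_lintegral_measure_lt hF (by linarith)]
        exact mul_le_mul_right (setLIntegral_mono' measurableSet_Ioi hslice) _
    _ = ENNReal.ofReal s * B * ((∫⁻ x, (B * g x) ^ (s - 1) ∂(μ.withDensity g)) /
          ENNReal.ofReal (s - 1)) := by
        rw [lintegral_const_mul' _ _ ENNReal.coe_ne_top,
          lintegral_rpow_eq_lintegral_measure_lt (by fun_prop) hs1, ← mul_assoc,
          mul_comm (ENNReal.ofReal (s - 1)), ENNReal.mul_div_cancel_right
            (by simpa using hs1) ENNReal.ofReal_ne_top]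
    _ = ENNReal.ofReal s / ENNReal.ofReal (s - 1) * B ^ s * ∫⁻ x, g x ^ s ∂μ := by
        rw [lintegral_withDensity_eq_lintegral_mul _ hg (by fun_prop)]
        simp only [Pi.mul_apply, ENNReal.mul_rpow_of_nonneg _ _ hs1.le,
          mul_left_comm (g _), ← rpow_eq_mul_rpow_sub_one _ hs.le]
        rw [lintegral_const_mul _ (by fun_prop), rpow_eq_mul_rpow_sub_one B hs.le,
          div_eq_mul_inv, div_eq_mul_inv]
        ring

theorem lintegral_rpow_le_of_truncated_weakType [SFinite μ] {F g : X → ℝ≥0∞}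
    (hg : Measurable g) {s : ℝ} (hs : 1 < s) {B : ℝ≥0}
    (h : ∀ l : ℝ≥0∞, l * μ {x | l < F x} ≤ B * ∫⁻ x in {x | l < B * g x}, g x ∂μ) :
    ∫⁻ x, F x ^ s ∂μ ≤
      ENNReal.ofReal s / ENNReal.ofReal (s - 1) * B ^ s * ∫⁻ x, g x ^ s ∂μ := by
  have hs0 : 0 < s := by linarith
  -- `∫⁻` is a lower integral, so the left side is attained by a measurable minorant of `F ^ s`.
  obtain ⟨G, hG, hGF, hGint⟩ := exists_measurable_le_lintegral_eq μ fun x => F x ^ s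
  have hroot : ∀ x, G x ^ s⁻¹ ≤ F x := fun x => (ENNReal.rpow_inv_le_iff hs0).2 (hGF x)
  calc ∫⁻ x, F x ^ s ∂μ = ∫⁻ x, (G x ^ s⁻¹) ^ s ∂μ := by
        simp only [ENNReal.rpow_inv_rpow hs0.ne', hGint]
    _ ≤ _ := lintegral_rpow_le_of_measurable_of_truncated_weakType (by fun_prop) hg hs
        fun l => le_trans (by gcongr; exact hroot _) (h l)

theorem countable_of_pairwiseDisjoint_of_lintegral_ne_zero {ι : Type*} {u : Set ι}
    {A : ι → Set X} (hA : ∀ i, MeasurableSet (A i)) (hdisj : u.PairwiseDisjoint A)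
    {g : X → ℝ≥0∞} (hg : ∫⁻ x, g x ∂μ ≠ ∞) (hpos : ∀ i ∈ u, ∫⁻ x in A i, g x ∂μ ≠ 0) :
    u.Countable := by
  have := isFiniteMeasure_withDensity hg
  have hcount := Measure.countable_meas_pos_of_disjoint_iUnion (μ := μ.withDensity g)
    (As := fun i : u => A i) (fun i => hA i)
    fun i j hij => hdisj i.2 j.2 fun h => hij (Subtype.ext h)
  have huniv : {i : u | 0 < μ.withDensity g (A i)} = Set.univ :=
    Set.eq_univ_of_forall fun i => by
      simpa only [Set.mem_ofPred_eq, withDensity_apply _ (hA i)] using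
        pos_iff_ne_zero.2 (hpos i i.2)
  rw [huniv, Set.countable_univ_iff] at hcount
  exact Set.countable_coe_iff.1 hcount

end MeasureSpace

/-! ### The maximal function of a family of pulled-back balls -/

/-- The centred Hardy–Littlewood maximal function of `g` along the balls
`φ ⁻¹' closedBall (φ x) θ`, `0 < θ ≤ R`, where the average is taken with respect to a
prescribed size `v x θ` in place of the measure of the ball. -/
def ballMaximal {X Y : Type*} [MeasurableSpace X] [PseudoMetricSpace Y] (μ : Measure X)
    (φ : X → Y) (v : X → ℝ → ℝ≥0∞) (R : ℝ) (g : X → ℝ≥0∞) (x : X) : ℝ≥0∞ :=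
  ⨆ θ ∈ Set.Ioc 0 R, (∫⁻ y in φ ⁻¹' Metric.closedBall (φ x) θ, g y ∂μ) / v x θ

section BallMaximal

variable {X Y : Type*} [MeasurableSpace X] [PseudoMetricSpace Y] {μ : Measure X} {φ : X → Y}
  {v : X → ℝ → ℝ≥0∞} {R : ℝ} {C : ℝ≥0}

theorem ballMaximal_le_ballMaximal_add_const {g₁ g₂ : X → ℝ≥0∞} (hg₁ : Measurable g₁)
    {c : ℝ≥0∞} (hg : ∀ y, g₂ y ≤ g₁ y + c)
    (hv : ∀ x, ∀ θ ∈ Set.Ioc 0 R, μ (φ ⁻¹' Metric.closedBall (φ x) (5 * θ)) ≤ C * v x θ)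
    (x : X) : ballMaximal μ φ v R g₂ x ≤ ballMaximal μ φ v R g₁ x + C * c := by
  refine iSup₂_le fun θ hθ => ?_
  have hconst : c * μ (φ ⁻¹' Metric.closedBall (φ x) θ) / v x θ ≤ C * c := by
    have hmono : μ (φ ⁻¹' Metric.closedBall (φ x) θ) ≤ C * v x θ :=
      (measure_mono (Set.preimage_mono
        (Metric.closedBall_subset_closedBall (by linarith [hθ.1])))).trans (hv x θ hθ)
    calc c * μ (φ ⁻¹' Metric.closedBall (φ x) θ) / v x θ ≤ c * (C * v x θ) / v x θ := by gcongr
      _ = C * c * (v x θ / v x θ) := by rw [← mul_assoc, mul_div_assoc, mul_comm c]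
      _ ≤ C * c := mul_le_of_le_one_right' ENNReal.div_self_le_one
  calc (∫⁻ y in φ ⁻¹' Metric.closedBall (φ x) θ, g₂ y ∂μ) / v x θ
      ≤ (∫⁻ y in φ ⁻¹' Metric.closedBall (φ x) θ, (g₁ y + c) ∂μ) / v x θ := by
        gcongr with y
        exact hg y
    _ = (∫⁻ y in φ ⁻¹' Metric.closedBall (φ x) θ, g₁ y ∂μ) / v x θ +
          c * μ (φ ⁻¹' Metric.closedBall (φ x) θ) / v x θ := by
        rw [lintegral_add_left hg₁, setLIntegral_const, ENNReal.add_div]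
    _ ≤ ballMaximal μ φ v R g₁ x + C * c := add_le_add (le_iSup₂_of_le θ hθ le_rfl) hconst

variable [MeasurableSpace Y] [OpensMeasurableSpace Y]

theorem mul_measure_lt_ballMaximal_le (hφ : Measurable φ) (hC : C ≠ 0)
    (hv : ∀ x, ∀ θ ∈ Set.Ioc 0 R, μ (φ ⁻¹' Metric.closedBall (φ x) (5 * θ)) ≤ C * v x θ)
    (g : X → ℝ≥0∞) (l : ℝ≥0∞) :
    l * μ {x | l < ballMaximal μ φ v R g x} ≤ C * ∫⁻ y, g y ∂μ := by
  rcases eq_or_ne (∫⁻ y, g y ∂μ) ∞ with htop | hfin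
  · rw [htop, ENNReal.mul_top (by simpa using hC)]
    exact le_top
  set ball : X × ℝ → Set X := fun a => φ ⁻¹' Metric.closedBall (φ a.1) a.2
  set T : Set (X × ℝ) := {a | a.2 ∈ Set.Ioc 0 R ∧ l < (∫⁻ y in ball a, g y ∂μ) / v a.1 a.2}
  have hball : ∀ a, MeasurableSet (ball a) := fun a => hφ Metric.isClosed_closedBall.measurableSet
  obtain ⟨u, huT, hdisj, hcov⟩ := Vitali.exists_disjoint_subfamily_covering_enlargement_closedBall
    T (fun a => φ a.1) (fun a => a.2) R (fun a ha => ha.1.2) 5 (by norm_num)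
  have hdisj' : u.PairwiseDisjoint ball := fun a ha b hb hab => (hdisj ha hb hab).preimage φ
  have hcount : u.Countable :=
    countable_of_pairwiseDisjoint_of_lintegral_ne_zero hball hdisj' hfin fun a ha hzero => by
      simpa [hzero] using (huT ha).2
  have hsub : {x | l < ballMaximal μ φ v R g x} ⊆
      ⋃ a ∈ u, φ ⁻¹' Metric.closedBall (φ a.1) (5 * a.2) := by
    intro x hx
    simp only [Set.mem_ofPred_eq, ballMaximal, lt_iSup_iff] at hx
    obtain ⟨θ, hθ, hlt⟩ := hx
    obtain ⟨b, hb, hsub⟩ := hcov (x, θ) ⟨hθ, hlt⟩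
    exact Set.mem_biUnion hb (hsub (Metric.mem_closedBall_self hθ.1.le))
  have hball_le : ∀ a : u, l * μ (φ ⁻¹' Metric.closedBall (φ a.1.1) (5 * a.1.2)) ≤
      C * ∫⁻ y in ball a, g y ∂μ := fun a => calc
    _ ≤ l * (C * v a.1.1 a.1.2) := by gcongr; exact hv _ _ (huT a.2).1
    _ = C * (l * v a.1.1 a.1.2) := mul_left_comm _ _ _
    _ ≤ _ := by gcongr; exact ENNReal.mul_le_of_le_div (huT a.2).2.le
  calc l * μ {x | l < ballMaximal μ φ v R g x}
      ≤ l * ∑' a : u, μ (φ ⁻¹' Metric.closedBall (φ a.1.1) (5 * a.1.2)) := by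
        gcongr
        exact (measure_mono hsub).trans (measure_biUnion_le _ hcount _)
    _ ≤ ∑' a : u, C * ∫⁻ y in ball a, g y ∂μ := by
        rw [← ENNReal.tsum_mul_left]
        exact ENNReal.tsum_le_tsum hball_le
    _ = C * ∫⁻ y in ⋃ a ∈ u, ball a, g y ∂μ := by
        rw [ENNReal.tsum_mul_left, lintegral_biUnion hcount (fun a _ => hball a) hdisj']
    _ ≤ C * ∫⁻ y, g y ∂μ := by gcongr; exact Measure.restrict_le_self

theorem mul_measure_lt_ballMaximal_le_setLIntegral (hφ : Measurable φ) (hC : C ≠ 0)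
    (hv : ∀ x, ∀ θ ∈ Set.Ioc 0 R, μ (φ ⁻¹' Metric.closedBall (φ x) (5 * θ)) ≤ C * v x θ)
    {g : X → ℝ≥0∞} (hg : Measurable g) (l : ℝ≥0∞) :
    l * μ {x | l < ballMaximal μ φ v R g x} ≤
      (2 * C : ℝ≥0) * ∫⁻ y in {y | l < (2 * C : ℝ≥0) * g y}, g y ∂μ := by
  set A : Set X := {y | l < (2 * C : ℝ≥0) * g y}
  have hA : MeasurableSet A := measurableSet_lt (by fun_prop) (by fun_prop)
  have hC0 : ((2 * C : ℝ≥0) : ℝ≥0∞) ≠ 0 := by simpa using hC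
  have hsplit : ∀ y, g y ≤ A.indicator g y + l / (2 * C : ℝ≥0) := by
    intro y
    by_cases hy : y ∈ A
    · rw [Set.indicator_of_mem hy]
      exact le_self_add
    · rw [Set.indicator_of_notMem hy, zero_add,
        ENNReal.le_div_iff_mul_le (Or.inl hC0) (Or.inl ENNReal.coe_ne_top), mul_comm]
      exact not_lt.1 hy
  have hhalf : C * (l / (2 * C : ℝ≥0)) = l / 2 := by
    rw [mul_comm 2 C, ENNReal.coe_mul, ENNReal.coe_ofNat, ← mul_div_assoc,
      ENNReal.mul_div_mul_left _ _ (by simpa using hC) ENNReal.coe_ne_top]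
  have hsub : {x | l < ballMaximal μ φ v R g x} ⊆
      {x | l / 2 < ballMaximal μ φ v R (A.indicator g) x} := by
    intro x (hx : l < _)
    by_contra hle
    rw [Set.mem_ofPred_eq, not_lt] at hle
    refine hx.not_ge ((ballMaximal_le_ballMaximal_add_const (hg.indicator hA) hsplit hv x).trans ?_)
    rw [hhalf]
    exact (add_le_add_left hle _).trans_eq (ENNReal.add_halves l)
  calc l * μ {x | l < ballMaximal μ φ v R g x}
      ≤ 2 * (l / 2 * μ {x | l / 2 < ballMaximal μ φ v R (A.indicator g) x}) := by
        rw [← mul_assoc, ENNReal.mul_div_cancel two_ne_zero ENNReal.ofNat_ne_top]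
        gcongr
    _ ≤ 2 * (C * ∫⁻ y, A.indicator g y ∂μ) := by
        exact mul_le_mul_right (mul_measure_lt_ballMaximal_le hφ hC hv _ _) _
    _ = (2 * C : ℝ≥0) * ∫⁻ y in A, g y ∂μ := by
        rw [lintegral_indicator hA, ← mul_assoc, ENNReal.coe_mul, ENNReal.coe_ofNat]

theorem lintegral_ballMaximal_rpow_le [SFinite μ] (hφ : Measurable φ) (hC : C ≠ 0)
    (hv : ∀ x, ∀ θ ∈ Set.Ioc 0 R, μ (φ ⁻¹' Metric.closedBall (φ x) (5 * θ)) ≤ C * v x θ)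
    {g : X → ℝ≥0∞} (hg : Measurable g) {s : ℝ} (hs : 1 < s) :
    ∫⁻ x, ballMaximal μ φ v R g x ^ s ∂μ ≤
      ENNReal.ofReal s / ENNReal.ofReal (s - 1) * (2 * C : ℝ≥0) ^ s * ∫⁻ x, g x ^ s ∂μ :=
  lintegral_rpow_le_of_truncated_weakType hg hs
    (mul_measure_lt_ballMaximal_le_setLIntegral hφ hC hv hg)

end BallMaximal

/-! ### Polar coordinates and boxes -/

section Polar

variable {F : Type*} [NormedAddCommGroup F] [NormedSpace ℝ F] [FiniteDimensional ℝ F]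
  [MeasurableSpace F] [BorelSpace F] [Nontrivial F] (μ : Measure F) [μ.IsAddHaarMeasure]

theorem lintegral_eq_lintegral_toSphere {f : F → ℝ≥0∞} (hf : Measurable f) :
    ∫⁻ z, f z ∂μ = ∫⁻ ω : Metric.sphere (0 : F) 1, (∫⁻ r in Set.Ioi (0 : ℝ),
      ENNReal.ofReal (r ^ (Module.finrank ℝ F - 1)) * f (r • (ω : F))) ∂μ.toSphere := by
  have hpolar : Measurable fun p : Metric.sphere (0 : F) 1 × Set.Ioi (0 : ℝ) =>
      f ((p.2 : ℝ) • (p.1 : F)) := by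
    fun_prop
  calc ∫⁻ z, f z ∂μ = ∫⁻ z : ({(0 : F)}ᶜ : Set F), f z ∂(μ.comap Subtype.val) := by
        rw [lintegral_subtype_comap (measurableSet_singleton _).compl,
          MeasureTheory.restrict_compl_singleton]
    _ = ∫⁻ p, f ((p.2 : ℝ) • (p.1 : F))
          ∂(μ.toSphere.prod (Measure.volumeIoiPow (Module.finrank ℝ F - 1))) := by
        rw [← μ.measurePreserving_homeomorphUnitSphereProd.lintegral_comp hpolar]
        refine lintegral_congr fun z => ?_
        have hz : ‖(z : F)‖ ≠ 0 := norm_ne_zero_iff.2 z.2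
        simp [smul_smul, hz]
    _ = ∫⁻ ω : Metric.sphere (0 : F) 1, ∫⁻ r : Set.Ioi (0 : ℝ), f ((r : ℝ) • (ω : F))
          ∂(Measure.volumeIoiPow (Module.finrank ℝ F - 1)) ∂μ.toSphere :=
        lintegral_prod _ hpolar.aemeasurable
    _ = _ := by
        refine lintegral_congr fun ω => ?_
        rw [Measure.volumeIoiPow, lintegral_withDensity_eq_lintegral_mul _ (by fun_prop)
          (by fun_prop)]
        exact lintegral_subtype_comap measurableSet_Ioi
          (fun r : ℝ => ENNReal.ofReal (r ^ (Module.finrank ℝ F - 1)) * f (r • (ω : F)))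

theorem mul_setLIntegral_toSphere_le_lintegral {f : F → ℝ≥0∞} (hf : Measurable f)
    {g : Metric.sphere (0 : F) 1 → ℝ≥0∞} {A : Set (Metric.sphere (0 : F) 1)}
    (hA : MeasurableSet A) {ε : ℝ}
    (hgf : ∀ ω ∈ A, ∀ r ∈ Set.Icc 1 (1 + ε), g ω ≤ f (r • (ω : F))) :
    ENNReal.ofReal ε * ∫⁻ ω in A, g ω ∂μ.toSphere ≤ ∫⁻ z, f z ∂μ := by
  rw [lintegral_eq_lintegral_toSphere μ hf, ← lintegral_const_mul' _ _ ENNReal.ofReal_ne_top]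
  refine (setLIntegral_mono' hA fun ω hω => ?_).trans (setLIntegral_le_lintegral A _)
  calc ENNReal.ofReal ε * g ω = ∫⁻ _ in Set.Icc 1 (1 + ε), g ω := by
        rw [setLIntegral_const, Real.volume_Icc, add_sub_cancel_left, mul_comm]
    _ ≤ ∫⁻ r in Set.Icc 1 (1 + ε),
          ENNReal.ofReal (r ^ (Module.finrank ℝ F - 1)) * f (r • (ω : F)) := by
        refine setLIntegral_mono' measurableSet_Icc fun r hr => (hgf ω hω r hr).trans ?_
        exact le_mul_of_one_le_left zero_le (ENNReal.one_le_ofReal.2 (one_le_pow₀ hr.1))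
    _ ≤ _ := lintegral_mono_set fun r hr => zero_lt_one.trans_le hr.1

theorem measure_le_mul_toSphere {Q : Set F} (hQ : MeasurableSet Q)
    {A : Set (Metric.sphere (0 : F) 1)} {ε : ℝ} (hε : 0 ≤ ε)
    (hQA : ∀ (ω : Metric.sphere (0 : F) 1) (r : ℝ), 0 < r → r • (ω : F) ∈ Q →
      r ∈ Set.Icc 1 (1 + ε) ∧ ω ∈ A) :
    μ Q ≤ ENNReal.ofReal (ε * (1 + ε) ^ (Module.finrank ℝ F - 1)) * μ.toSphere A := by
  have hray : ∀ ω : Metric.sphere (0 : F) 1, (∫⁻ r in Set.Ioi (0 : ℝ),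
      ENNReal.ofReal (r ^ (Module.finrank ℝ F - 1)) * Q.indicator 1 (r • (ω : F))) ≤
        ENNReal.ofReal (ε * (1 + ε) ^ (Module.finrank ℝ F - 1)) * A.indicator 1 ω := by
    intro ω
    calc ∫⁻ r in Set.Ioi (0 : ℝ),
          ENNReal.ofReal (r ^ (Module.finrank ℝ F - 1)) * Q.indicator 1 (r • (ω : F))
        ≤ ∫⁻ r in Set.Ioi (0 : ℝ), (Set.Icc 1 (1 + ε)).indicator (fun _ =>
            ENNReal.ofReal ((1 + ε) ^ (Module.finrank ℝ F - 1)) * A.indicator 1 ω) r := by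
          refine setLIntegral_mono' measurableSet_Ioi fun r hr => ?_
          by_cases hrQ : r • (ω : F) ∈ Q
          · obtain ⟨hr1, hωA⟩ := hQA ω r hr hrQ
            have hr0 : (0 : ℝ) ≤ r := le_of_lt hr
            simp only [Set.indicator_of_mem hrQ, Set.indicator_of_mem hωA,
              Set.indicator_of_mem hr1, Pi.one_apply, mul_one]
            exact ENNReal.ofReal_le_ofReal (pow_le_pow_left₀ hr0 hr1.2 _)
          · simp only [Set.indicator_of_notMem hrQ, mul_zero, zero_le]
      _ ≤ ∫⁻ r, (Set.Icc 1 (1 + ε)).indicator (fun _ =>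
            ENNReal.ofReal ((1 + ε) ^ (Module.finrank ℝ F - 1)) * A.indicator 1 ω) r :=
          setLIntegral_le_lintegral _ _
      _ = _ := by
          rw [lintegral_indicator_const measurableSet_Icc, Real.volume_Icc, add_sub_cancel_left,
            ENNReal.ofReal_mul hε]
          ring
  rw [← lintegral_indicator_one hQ,
    lintegral_eq_lintegral_toSphere μ (measurable_one.indicator hQ)]
  refine (lintegral_mono hray).trans ?_
  rw [lintegral_const_mul' _ _ ENNReal.ofReal_ne_top]
  gcongr
  exact lintegral_indicator_one_le _

end Polar

theorem lintegral_pi_prod_eq_prod_lintegral {n : ℕ} {X : Type*} [MeasurableSpace X]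
    {μ : Fin n → Measure X} [∀ i, SigmaFinite (μ i)] {f : Fin n → X → ℝ≥0∞}
    (hf : ∀ i, Measurable (f i)) :
    ∫⁻ x, ∏ i, f i (x i) ∂(Measure.pi μ) = ∏ i, ∫⁻ s, f i s ∂(μ i) := by
  induction n with
  | zero => simp
  | succ n ih =>
    have htail : Measurable fun x : Fin n → X => ∏ i, f i.succ (x i) :=
      Finset.measurable_prod _ fun i _ => (hf i.succ).comp (measurable_pi_apply i)
    rw [← (measurePreserving_piFinSuccAbove μ 0).symm.lintegral_comp (by fun_prop),
      Fin.prod_univ_succ, ← ih fun i => hf i.succ]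
    simp only [MeasurableEquiv.piFinSuccAbove_symm_apply, Fin.insertNthEquiv,
      Fin.prod_univ_succ, Fin.insertNth_zero, Equiv.coe_fn_mk, Fin.cons_succ, Fin.cons_zero]
    exact lintegral_prod_mul (hf 0).aemeasurable htail.aemeasurable

theorem lintegral_euclideanSpace_prod_eq_prod_lintegral {n : ℕ} {f : Fin n → ℝ → ℝ≥0∞}
    (hf : ∀ i, Measurable (f i)) :
    ∫⁻ z : EuclideanSpace ℝ (Fin n), ∏ i, f i (z i) = ∏ i, ∫⁻ s, f i s := by
  rw [← lintegral_pi_prod_eq_prod_lintegral hf,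
    ← (PiLp.volume_preserving_toLp (Fin n)).lintegral_comp (by fun_prop)]
  rfl

theorem volume_euclideanSpace_box {ι : Type*} [Fintype ι] (l u : ι → ℝ) :
    volume {z : EuclideanSpace ℝ ι | ∀ j, z j ∈ Set.Icc (l j) (u j)} =
      ∏ j, ENNReal.ofReal (u j - l j) := by
  rw [← Real.volume_Icc_pi, ← (PiLp.volume_preserving_toLp ι).measure_preimage
    (by measurability)]
  congr 1
  ext z
  simp [Set.mem_Icc, Pi.le_def, forall_and]

theorem norm_le_card_mul_of_forall_abs_le {ι : Type*} [Fintype ι] {z : EuclideanSpace ℝ ι}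
    {a : ℝ} (h : ∀ j, |z j| ≤ a) : ‖z‖ ≤ Fintype.card ι * a := by
  calc ‖z‖ ≤ ∑ j, |z j| := by
        rw [EuclideanSpace.norm_eq]
        exact Real.sqrt_le_iff.2
          ⟨by positivity, Finset.sum_sq_le_sq_sum_of_nonneg fun j _ => norm_nonneg _⟩
    _ ≤ Fintype.card ι * a := by
        rw [← nsmul_eq_mul]
        exact Finset.sum_le_card_nsmul _ _ a fun j _ => h j

/-! ### Balls for the coordinatewise absolute values -/

section Balls

variable {d : ℕ}

instance : IsFiniteMeasure (surface d) :=
  inferInstanceAs (IsFiniteMeasure (volume : Measure (E d)).toSphere)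

theorem abs_apply_le_one (x : S d) (j : Fin (d + 1)) : |(x : E d) j| ≤ 1 := by
  have := PiLp.norm_apply_le (x : E d) j
  rwa [norm_eq_of_mem_sphere, Real.norm_eq_abs] at this

theorem weight_sq (τ : Fin (d + 1) → ℝ) (x : E d) :
    weight τ x ^ 2 = ∏ j, |x j| ^ (2 * τ j) := by
  rw [weight, ← Finset.prod_pow]
  refine Finset.prod_congr rfl fun j _ => ?_
  rw [mul_comm, Real.rpow_mul (abs_nonneg _), Real.rpow_two]

@[fun_prop]
theorem measurable_weight (τ : Fin (d + 1) → ℝ) : Measurable (weight τ : E d → ℝ) := by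
  unfold weight
  fun_prop

/-- The projection of the sphere to the closed positive orthant along the orbits of `ℤ₂^{d+1}`. -/
def absCoord (x : S d) : Fin (d + 1) → ℝ := fun j => |(x : E d) j|

theorem measurable_absCoord : Measurable (absCoord : S d → Fin (d + 1) → ℝ) := by
  unfold absCoord
  fun_prop

/-- The points of the sphere whose coordinates agree with those of `x` in absolute value up to
`θ`: the preimage under `absCoord` of a ball of the sup metric. -/
def absBall (x : S d) (θ : ℝ) : Set (S d) := absCoord ⁻¹' Metric.closedBall (absCoord x) θ

theorem mem_absBall {x y : S d} {θ : ℝ} (hθ : 0 ≤ θ) :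
    y ∈ absBall x θ ↔ ∀ j, |(|(y : E d) j| - |(x : E d) j|)| ≤ θ :=
  dist_pi_le_iff hθ

theorem measurableSet_absBall (x : S d) (θ : ℝ) : MeasurableSet (absBall x θ) :=
  measurable_absCoord Metric.isClosed_closedBall.measurableSet

/-- The size of `absBall x θ` with respect to `h_τ² dω`, up to constants. -/
def ballSize (τ : Fin (d + 1) → ℝ) (x : S d) (θ : ℝ) : ℝ :=
  θ ^ d * ∏ j, (|(x : E d) j| + θ) ^ (2 * τ j)

theorem ballSize_pos (τ : Fin (d + 1) → ℝ) (x : S d) {θ : ℝ} (hθ : 0 < θ) :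
    0 < ballSize τ x θ := by
  unfold ballSize
  positivity

theorem ballSize_mul_le (τ : Fin (d + 1) → ℝ) (x : S d) {K θ : ℝ} (hK : 1 ≤ K) (hθ : 0 < θ) :
    ballSize τ x (K * θ) ≤ (K ^ d * ∏ j, K ^ |2 * τ j|) * ballSize τ x θ := by
  have hfactor : ∀ j, (|(x : E d) j| + K * θ) ^ (2 * τ j) ≤
      K ^ |2 * τ j| * (|(x : E d) j| + θ) ^ (2 * τ j) := fun j =>
    rpow_le_mul_rpow_of_le_mul _ (by positivity) (by positivity) (by positivity)
      (by nlinarith [mul_nonneg (sub_nonneg.2 hK) hθ.le,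
        mul_nonneg (sub_nonneg.2 hK) (abs_nonneg ((x : E d) j)),
        mul_nonneg (mul_nonneg (sub_nonneg.2 hK) hθ.le) (zero_le_one.trans hK)])
      (by nlinarith [mul_nonneg (sub_nonneg.2 hK) (abs_nonneg ((x : E d) j))])
  calc ballSize τ x (K * θ)
      ≤ (K * θ) ^ d * ∏ j, (K ^ |2 * τ j| * (|(x : E d) j| + θ) ^ (2 * τ j)) := by
        unfold ballSize
        gcongr with j
        exact hfactor j
    _ = (K ^ d * ∏ j, K ^ |2 * τ j|) * ballSize τ x θ := by
        rw [Finset.prod_mul_distrib, mul_pow, ballSize]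
        ring

/-- The density `h_τ²` on `ℝ^{d+1}`, cut off to the points whose coordinates agree with `u` in
absolute value up to `θ`. -/
def boxWeight (τ u : Fin (d + 1) → ℝ) (θ : ℝ) (z : E d) : ℝ≥0∞ :=
  ∏ j, (abs ⁻¹' Metric.closedBall (u j) θ).indicator
    (fun s => ENNReal.ofReal (|s| ^ (2 * τ j))) (z j)

theorem measurable_boxWeight_factor (e u θ : ℝ) : Measurable
    ((abs ⁻¹' Metric.closedBall u θ).indicator fun s => ENNReal.ofReal (|s| ^ e)) :=
  Measurable.indicator (by fun_prop) (measurable_norm Metric.isClosed_closedBall.measurableSet)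

theorem measurable_boxWeight (τ u : Fin (d + 1) → ℝ) (θ : ℝ) : Measurable (boxWeight τ u θ) :=
  Finset.measurable_prod _ fun j _ =>
    (measurable_boxWeight_factor (2 * τ j) (u j) θ).comp (by fun_prop)

theorem exists_lintegral_boxWeight_le {τ : Fin (d + 1) → ℝ} (hτ : ∀ j, -(1 / 2 : ℝ) < τ j) :
    ∃ C : ℝ, 0 < C ∧ ∀ (x : S d) (θ : ℝ), 0 < θ →
      ∫⁻ z, boxWeight τ (absCoord x) θ z ≤ ENNReal.ofReal (θ * (C * ballSize τ x θ)) := by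
  choose C hC0 hC using fun j =>
    exists_lintegral_abs_preimage_closedBall_rpow_le (e := 2 * τ j) (by linarith [hτ j])
  refine ⟨∏ j, C j, Finset.prod_pos fun j _ => hC0 j, fun x θ hθ => ?_⟩
  calc ∫⁻ z, boxWeight τ (absCoord x) θ z
      = ∏ j, ∫⁻ s in abs ⁻¹' Metric.closedBall |(x : E d) j| θ,
          ENNReal.ofReal (|s| ^ (2 * τ j)) := by
        unfold boxWeight
        rw [lintegral_euclideanSpace_prod_eq_prod_lintegral fun j =>
          measurable_boxWeight_factor (2 * τ j) _ θ]
        refine Finset.prod_congr rfl fun j _ => lintegral_indicator ?_ _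
        exact measurable_norm Metric.isClosed_closedBall.measurableSet
    _ ≤ ∏ j, ENNReal.ofReal (C j * (θ * (|(x : E d) j| + θ) ^ (2 * τ j))) :=
        Finset.prod_le_prod' fun j _ => hC j _ θ (abs_nonneg _) hθ
    _ = ENNReal.ofReal (θ * ((∏ j, C j) * ballSize τ x θ)) := by
        rw [← ENNReal.ofReal_prod_of_nonneg fun j _ => mul_nonneg (hC0 j).le (by positivity),
          Finset.prod_mul_distrib, Finset.prod_mul_distrib, ballSize, Finset.prod_const,
          Finset.card_univ, Fintype.card_fin]
        congr 1; ring

theorem rpow_abs_le_mul_rpow_abs_mul {r K : ℝ} (s e : ℝ) (hr : 1 ≤ r) (hrK : r ≤ K) :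
    |s| ^ e ≤ K ^ |e| * |r * s| ^ e := by
  have hK : 1 ≤ K := hr.trans hrK
  rcases eq_or_ne s 0 with rfl | hs
  · rw [mul_zero]
    exact le_mul_of_one_le_left (Real.rpow_nonneg (abs_nonneg _) _)
      (Real.one_le_rpow hK (abs_nonneg _))
  · have hs' : 0 < |s| := abs_pos.2 hs
    rw [abs_mul, abs_of_pos (by linarith : 0 < r)]
    refine rpow_le_mul_rpow_of_le_mul e (by positivity) hs' (by linarith) (by gcongr) ?_
    nlinarith [mul_le_mul hK hr zero_le_one (by linarith)]

theorem weight_sq_le_mul_boxWeight (τ : Fin (d + 1) → ℝ) {x ω : S d} {θ ρ r K : ℝ} (hθ : 0 ≤ θ)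
    (hρ : 0 ≤ ρ) (hω : ω ∈ absBall x ρ) (hr : r ∈ Set.Icc 1 (1 + θ)) (hK : 1 + θ ≤ K) :
    ENNReal.ofReal (weight τ (ω : E d) ^ 2) ≤
      ENNReal.ofReal (∏ j, K ^ |2 * τ j|) * boxWeight τ (absCoord x) (ρ + θ) (r • (ω : E d)) := by
  have hK0 : 0 ≤ K := by linarith
  have hr0 : 0 < r := by linarith [hr.1]
  have hmem : ∀ j, (r • (ω : E d)) j ∈ abs ⁻¹' Metric.closedBall |(x : E d) j| (ρ + θ) := by
    intro j
    rw [PiLp.smul_apply, smul_eq_mul, Set.mem_preimage, Metric.mem_closedBall, Real.dist_eq,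
      abs_mul, abs_of_pos hr0, abs_le]
    have hωj := abs_le.1 ((mem_absBall hρ).1 hω j)
    have hupper : (r - 1) * |(ω : E d) j| ≤ θ * 1 :=
      mul_le_mul (by linarith [hr.2]) (abs_apply_le_one ω j) (abs_nonneg _) hθ
    have hlower : 0 ≤ (r - 1) * |(ω : E d) j| :=
      mul_nonneg (by linarith [hr.1]) (abs_nonneg _)
    constructor <;> linarith
  have hbox : boxWeight τ (absCoord x) (ρ + θ) (r • (ω : E d)) =
      ENNReal.ofReal (∏ j, |r * (ω : E d) j| ^ (2 * τ j)) := by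
    rw [ENNReal.ofReal_prod_of_nonneg fun j _ => by positivity]
    exact Finset.prod_congr rfl fun j _ => Set.indicator_of_mem (hmem j) _
  rw [hbox, weight_sq, ← ENNReal.ofReal_mul (by positivity), ← Finset.prod_mul_distrib]
  gcongr with j
  exact rpow_abs_le_mul_rpow_abs_mul _ _ hr.1 (hr.2.trans hK)

theorem exists_weightedMeasure_absBall_le {τ : Fin (d + 1) → ℝ}
    (hτ : ∀ j, -(1 / 2 : ℝ) < τ j) {K R : ℝ} (hK : 1 ≤ K) (hR : 0 ≤ R) :
    ∃ C : ℝ≥0, C ≠ 0 ∧ ∀ (x : S d), ∀ θ ∈ Set.Ioc 0 R,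
      weightedMeasure τ (absBall x (K * θ)) ≤ C * ENNReal.ofReal (ballSize τ x θ) := by
  obtain ⟨C, hC0, hC⟩ := exists_lintegral_boxWeight_le hτ
  set M : ℝ := ∏ j, (1 + R) ^ |2 * τ j|
  have hM : 0 < M := by positivity
  set D : ℝ := (K + 1) ^ d * ∏ j, (K + 1) ^ |2 * τ j|
  have : 0 < D := by positivity
  have hpos : 0 < M * ((K + 1) * (C * D)) := by positivity
  refine ⟨Real.toNNReal _, (Real.toNNReal_pos.2 hpos).ne', fun x θ ⟨hθ, hθR⟩ => ?_⟩
  have hKθ : K * θ + θ = (K + 1) * θ := by ring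
  have hshell : ENNReal.ofReal θ * weightedMeasure τ (absBall x (K * θ)) ≤
      ENNReal.ofReal θ * ENNReal.ofReal (M * ((K + 1) * (C * D)) * ballSize τ x θ) := by
    calc ENNReal.ofReal θ * weightedMeasure τ (absBall x (K * θ))
        ≤ ∫⁻ z, ENNReal.ofReal M * boxWeight τ (absCoord x) (K * θ + θ) z := by
          rw [weightedMeasure, withDensity_apply _ (measurableSet_absBall _ _)]
          exact mul_setLIntegral_toSphere_le_lintegral volume
            ((measurable_boxWeight _ _ _).const_mul _) (measurableSet_absBall _ _)
            fun ω hω r hr => weight_sq_le_mul_boxWeight τ hθ.le (by positivity) hω hr (by linarith)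
      _ ≤ ENNReal.ofReal M *
            ENNReal.ofReal ((K + 1) * θ * (C * ballSize τ x ((K + 1) * θ))) := by
          rw [lintegral_const_mul' _ _ ENNReal.ofReal_ne_top, hKθ]
          exact mul_le_mul_right (hC x _ (by positivity)) _
      _ ≤ ENNReal.ofReal M * ENNReal.ofReal ((K + 1) * θ * (C * (D * ballSize τ x θ))) := by
          gcongr
          exact ballSize_mul_le τ x (by linarith) hθ
      _ = _ := by
          rw [← ENNReal.ofReal_mul hM.le, ← ENNReal.ofReal_mul hθ.le]
          congr 1; ring
  have hcancel := (ENNReal.mul_le_mul_iff_right (by simpa using hθ)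
    ENNReal.ofReal_ne_top).1 hshell
  rwa [ENNReal.ofReal_mul hpos.le] at hcancel

/-- The cube of side `s` one of whose corners is `x` moved by `s` away from all the coordinate
hyperplanes; a vanishing coordinate is moved to the positive side. -/
def outwardCube (x : E d) (s : ℝ) : Set (E d) :=
  {z | ∀ j, z j ∈ if 0 ≤ x j then Set.Icc (x j + s) (x j + 2 * s)
    else Set.Icc (x j - 2 * s) (x j - s)}

theorem isClosed_outwardCube (x : E d) (s : ℝ) : IsClosed (outwardCube x s) := by
  unfold outwardCube
  simp only [Set.ofPred_forall]
  refine isClosed_iInter fun j => ?_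
  split_ifs <;> exact isClosed_Icc.preimage (by fun_prop)

theorem volume_outwardCube (x : E d) {s : ℝ} (hs : 0 ≤ s) :
    volume (outwardCube x s) = ENNReal.ofReal (s ^ (d + 1)) := by
  have hbox : outwardCube x s = {z | ∀ j, z j ∈ Set.Icc (if 0 ≤ x j then x j + s else x j - 2 * s)
      (if 0 ≤ x j then x j + 2 * s else x j - s)} := by
    ext z
    refine forall_congr' fun j => ?_
    split_ifs <;> rfl
  have hside : ∀ j, (if 0 ≤ x j then x j + 2 * s else x j - s) -
      (if 0 ≤ x j then x j + s else x j - 2 * s) = s := by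
    intro j
    split_ifs <;> ring
  rw [hbox, volume_euclideanSpace_box]
  simp only [hside, Finset.prod_const, Finset.card_univ, Fintype.card_fin,
    ENNReal.ofReal_pow hs]

section OutwardCube

variable {x : E d} {z : E d} {s : ℝ}

theorem abs_sub_le_of_mem_outwardCube (hs : 0 ≤ s) (hz : z ∈ outwardCube x s) (j : Fin (d + 1)) :
    |z j - x j| ≤ 2 * s := by
  have hzj := hz j
  split_ifs at hzj <;> exact abs_le.2 ⟨by linarith [hzj.1], by linarith [hzj.2]⟩

theorem abs_add_le_abs_of_mem_outwardCube (hz : z ∈ outwardCube x s) (j : Fin (d + 1)) :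
    |x j| + s ≤ |z j| := by
  have hzj := hz j
  split_ifs at hzj with hx
  · exact le_abs.2 (Or.inl (by rw [abs_of_nonneg hx]; exact hzj.1))
  · exact le_abs.2 (Or.inr (by rw [abs_of_neg (not_le.1 hx)]; linarith [hzj.2]))

theorem mul_nonneg_of_mem_outwardCube (hs : 0 ≤ s) (hz : z ∈ outwardCube x s)
    (j : Fin (d + 1)) : 0 ≤ x j * z j := by
  have hzj := hz j
  split_ifs at hzj with hx
  · exact mul_nonneg hx (by linarith [hzj.1])
  · exact mul_nonneg_of_nonpos_of_nonpos (not_le.1 hx).le (by linarith [hzj.2, not_le.1 hx])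

theorem norm_sub_le_of_mem_outwardCube (hs : 0 ≤ s) (hz : z ∈ outwardCube x s) :
    ‖z - x‖ ≤ 2 * (d + 1) * s := by
  refine (norm_le_card_mul_of_forall_abs_le (a := 2 * s)
    fun j => abs_sub_le_of_mem_outwardCube hs hz j).trans_eq ?_
  push_cast [Fintype.card_fin]
  ring

theorem norm_le_norm_of_mem_outwardCube (hs : 0 ≤ s) (hz : z ∈ outwardCube x s) :
    ‖x‖ ≤ ‖z‖ := by
  rw [EuclideanSpace.norm_eq, EuclideanSpace.norm_eq]
  gcongr with j
  simp only [Real.norm_eq_abs]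
  linarith [abs_add_le_abs_of_mem_outwardCube hz j]

end OutwardCube

section

variable {x ω : S d} {r s : ℝ}

theorem mem_Icc_of_smul_mem_outwardCube (hs : 0 ≤ s) (hr : 0 < r)
    (hω : r • (ω : E d) ∈ outwardCube (x : E d) s) : r ∈ Set.Icc 1 (1 + 2 * (d + 1) * s) := by
  have hnorm : ‖r • (ω : E d)‖ = r := by
    rw [norm_smul, norm_eq_of_mem_sphere, mul_one, Real.norm_of_nonneg hr.le]
  have hlower := norm_le_norm_of_mem_outwardCube hs hω
  have hupper := (norm_le_norm_add_norm_sub' (r • (ω : E d)) x).trans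
    (add_le_add_right (norm_sub_le_of_mem_outwardCube hs hω) _)
  rw [hnorm, norm_eq_of_mem_sphere] at hlower hupper
  exact ⟨hlower, hupper⟩

theorem norm_sub_le_of_smul_mem_outwardCube (hs : 0 ≤ s) (hr : 0 < r)
    (hω : r • (ω : E d) ∈ outwardCube (x : E d) s) : ‖(ω : E d) - x‖ ≤ 4 * (d + 1) * s := by
  obtain ⟨hr1, hr2⟩ := mem_Icc_of_smul_mem_outwardCube hs hr hω
  have hradial : ‖(ω : E d) - r • (ω : E d)‖ ≤ 2 * (d + 1) * s := by
    rw [show (ω : E d) - r • (ω : E d) = (1 - r) • (ω : E d) by rw [sub_smul, one_smul], norm_smul,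
      norm_eq_of_mem_sphere, mul_one, Real.norm_eq_abs, abs_le]
    constructor <;> linarith
  calc ‖(ω : E d) - x‖ ≤ ‖(ω : E d) - r • (ω : E d)‖ + ‖r • (ω : E d) - x‖ :=
        norm_sub_le_norm_sub_add_norm_sub _ _ _
    _ ≤ 4 * (d + 1) * s := by linarith [norm_sub_le_of_mem_outwardCube hs hω]

end

/-- The part of a small cap around `x` that lies in the same orthant as `x`, at distance
comparable to `|x j| + θ` from the coordinate hyperplanes. -/
def innerCap (η c : ℝ) (x : S d) (θ : ℝ) : Set (S d) :=
  {y | ‖(y : E d) - x‖ ≤ η * θ ∧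
    ∀ j, 0 ≤ (x : E d) j * (y : E d) j ∧ c * (|(x : E d) j| + θ) ≤ |(y : E d) j|}

theorem mem_innerCap_of_smul_mem_outwardCube {x ω : S d} {a c r η θ : ℝ} (ha : 0 ≤ a)
    (ha1 : a ≤ 1) (haη : 4 * (d + 1) * a ≤ η) (hθ : 0 < θ) (hr : 0 < r) (hrc : r * c ≤ a)
    (hω : r • (ω : E d) ∈ outwardCube (x : E d) (a * θ)) : ω ∈ innerCap η c x θ := by
  have haθ : 0 ≤ a * θ := by positivity
  refine ⟨?_, fun j => ⟨?_, ?_⟩⟩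
  · calc ‖(ω : E d) - x‖ ≤ 4 * (d + 1) * (a * θ) := norm_sub_le_of_smul_mem_outwardCube haθ hr hω
      _ = 4 * (d + 1) * a * θ := by ring
      _ ≤ η * θ := by gcongr
  · have hsign := mul_nonneg_of_mem_outwardCube haθ hω j
    rw [PiLp.smul_apply, smul_eq_mul, mul_left_comm] at hsign
    exact nonneg_of_mul_nonneg_right hsign hr
  · have habs := abs_add_le_abs_of_mem_outwardCube hω j
    rw [PiLp.smul_apply, smul_eq_mul, abs_mul, abs_of_pos hr] at habs
    refine le_of_mul_le_mul_left ?_ hr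
    calc r * (c * (|(x : E d) j| + θ)) = r * c * (|(x : E d) j| + θ) := by ring
      _ ≤ a * (|(x : E d) j| + θ) := by gcongr
      _ ≤ |(x : E d) j| + a * θ := by nlinarith [abs_nonneg ((x : E d) j)]
      _ ≤ r * |(ω : E d) j| := habs

theorem le_surface_innerCap (x : S d) {a b c η θ : ℝ} (ha : 0 < a) (ha1 : a ≤ 1)
    (hab : 2 * (d + 1) * a = b) (hbη : 2 * b ≤ η) (hc : 0 ≤ c) (hca : (1 + b * θ) * c ≤ a)
    (hθ : 0 < θ) :
    ENNReal.ofReal ((a * θ) ^ (d + 1) / (b * θ * (1 + b * θ) ^ d)) ≤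
      surface d (innerCap η c x θ) := by
  have hb : 0 < b := by rw [← hab]; positivity
  have hdim : Module.finrank ℝ (E d) - 1 = d := by simp
  have hcone : ∀ (ω : S d) (r : ℝ), 0 < r → r • (ω : E d) ∈ outwardCube (x : E d) (a * θ) →
      r ∈ Set.Icc 1 (1 + b * θ) ∧ ω ∈ innerCap η c x θ := by
    intro ω r hr hω
    have hrb := mem_Icc_of_smul_mem_outwardCube (by positivity) hr hω
    rw [← mul_assoc, hab] at hrb
    refine ⟨hrb, mem_innerCap_of_smul_mem_outwardCube ha.le ha1 (by linarith) hθ hr ?_ hω⟩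
    exact (mul_le_mul_of_nonneg_right hrb.2 hc).trans hca
  have hcube := measure_le_mul_toSphere volume
    (isClosed_outwardCube (x : E d) (a * θ)).measurableSet (by positivity) hcone
  rw [volume_outwardCube _ (by positivity), hdim] at hcube
  rw [ENNReal.ofReal_div_of_pos (by positivity)]
  exact ENNReal.div_le_of_le_mul' hcube

theorem exists_le_surface_innerCap (d : ℕ) {η R : ℝ} (hη : 0 < η) (hR : 0 ≤ R) :
    ∃ c : ℝ, 0 < c ∧ ∀ (x : S d), ∀ θ ∈ Set.Ioc 0 R,
      ENNReal.ofReal (c * θ ^ d) ≤ surface d (innerCap η c x θ) := by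
  obtain ⟨a, ha0, ha1, haη⟩ : ∃ a : ℝ, 0 < a ∧ a ≤ 1 ∧ 4 * (d + 1) * a ≤ η :=
    ⟨min 1 (η / (4 * (d + 1))), by positivity, min_le_left _ _, by
      rw [← le_div_iff₀' (by positivity)]; exact min_le_right _ _⟩
  obtain ⟨b, hab⟩ : ∃ b, 2 * (d + 1) * a = b := ⟨_, rfl⟩
  have hb : 0 < b := by rw [← hab]; positivity
  set K : ℝ := 1 + b * R
  have hK : 0 < K := by positivity
  set c : ℝ := min (a / K) (a ^ (d + 1) / (b * K ^ d))
  have hc : 0 < c := by positivity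
  refine ⟨c, hc, fun x θ ⟨hθ, hθR⟩ => ?_⟩
  have hKθ : 1 + b * θ ≤ K := by simp only [K]; gcongr
  have hca : (1 + b * θ) * c ≤ a := by
    calc (1 + b * θ) * c ≤ K * (a / K) := by gcongr; exact min_le_left _ _
      _ = a := mul_div_cancel₀ _ hK.ne'
  refine le_trans (ENNReal.ofReal_le_ofReal ?_)
    (le_surface_innerCap x ha0 ha1 hab (by linarith) hc.le hca hθ)
  calc c * θ ^ d ≤ a ^ (d + 1) / (b * K ^ d) * θ ^ d := by gcongr; exact min_le_right _ _
    _ = (a * θ) ^ (d + 1) / (b * θ * K ^ d) := by rw [mul_pow, pow_succ θ d]; field_simp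
    _ ≤ _ := by gcongr

end Balls

/-! ### Bounds for the kernel `V_κ[χ_{B(x,θ)}](y)` -/

section Kernel

variable {d : ℕ}

/-- The probability measure on `[-1,1]^{d+1}` that represents `V_κ`. -/
abbrev cubeMeasure (κ : Fin (d + 1) → ℝ) : Measure (Fin (d + 1) → ℝ) :=
  Measure.pi fun i => factorMeasure (κ i)

/-- The coordinatewise product of `y` and `t`, as a point of Euclidean space. -/
abbrev hadamard (y : E d) (t : Fin (d + 1) → ℝ) : E d := WithLp.toLp 2 fun i => y i * t i

variable {κ : Fin (d + 1) → ℝ}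

theorem isProbabilityMeasure_cubeMeasure (hκ : ∀ j, 0 ≤ κ j) :
    IsProbabilityMeasure (cubeMeasure κ) := by
  have := fun j => isProbabilityMeasure_factorMeasure (hκ j)
  infer_instance

theorem ae_cubeMeasure_abs_le_one (hκ : ∀ j, 0 ≤ κ j) :
    ∀ᵐ t ∂(cubeMeasure κ), ∀ j, |t j| ≤ 1 := by
  have := fun j => isProbabilityMeasure_factorMeasure (hκ j)
  rw [ae_all_iff]
  exact fun j => (Measure.tendsto_eval_ae_ae (μ := fun i => factorMeasure (κ i))).eventually
    (ae_factorMeasure_abs_le_one (κ j))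

theorem isClosed_solidCap (x : E d) (θ : ℝ) : IsClosed (solidCap x θ) := by
  have hnorm : IsClosed {y : E d | ‖y‖ ≤ 1} := isClosed_le (by fun_prop) (by fun_prop)
  have hinner : IsClosed {y : E d | Real.cos θ ≤ inner ℝ x y} :=
    isClosed_le (by fun_prop) (by fun_prop)
  exact hnorm.inter hinner

theorem ofReal_kernel (hκ : ∀ j, 0 ≤ κ j) (x : E d) (θ : ℝ) (y : E d) :
    ENNReal.ofReal (kernel κ x θ y) = cubeMeasure κ (hadamard y ⁻¹' solidCap x θ) := by
  have := isProbabilityMeasure_cubeMeasure hκ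
  have hhadamard : Measurable (hadamard y) := by unfold hadamard; fun_prop
  have hkernel : kernel κ x θ y = (cubeMeasure κ).real (hadamard y ⁻¹' solidCap x θ) := by
    rw [kernel, V, ← integral_indicator_one (hhadamard (isClosed_solidCap x θ).measurableSet)]
    rfl
  rw [hkernel, ofReal_measureReal]

theorem inner_hadamard (x y : E d) (t : Fin (d + 1) → ℝ) :
    inner ℝ x (hadamard y t) = ∑ j, x j * y j * t j := by
  rw [PiLp.inner_apply]
  refine Finset.sum_congr rfl fun j _ => ?_
  simp only [RCLike.inner_apply, conj_trivial]
  ring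

theorem norm_hadamard_le (y : E d) {t : Fin (d + 1) → ℝ} (ht : ∀ j, |t j| ≤ 1) :
    ‖hadamard y t‖ ≤ ‖y‖ := by
  rw [EuclideanSpace.norm_eq, EuclideanSpace.norm_eq]
  gcongr with j
  rw [norm_mul]
  exact mul_le_of_le_one_right (norm_nonneg _) (ht j)

theorem mul_le_abs_of_abs_le_one (p : ℝ) {t : ℝ} (ht : |t| ≤ 1) : p * t ≤ |p| :=
  calc p * t ≤ |p| * |t| := (le_abs_self _).trans_eq (abs_mul _ _)
    _ ≤ |p| := mul_le_of_le_one_right (abs_nonneg _) ht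

theorem sum_sq_abs_sub_abs (x y : S d) : ∑ j, (|(y : E d) j| - |(x : E d) j|) ^ 2 =
    2 - 2 * ∑ j, |(x : E d) j * (y : E d) j| := by
  have hone : ∀ z : S d, ∑ j, (z : E d) j ^ 2 = 1 := fun z => by
    rw [← EuclideanSpace.real_norm_sq_eq, norm_eq_of_mem_sphere, one_pow]
  have hterm : ∀ j, (|(y : E d) j| - |(x : E d) j|) ^ 2 =
      (y : E d) j ^ 2 + (x : E d) j ^ 2 - 2 * |(x : E d) j * (y : E d) j| := by
    intro j
    rw [abs_mul, sub_sq, sq_abs, sq_abs]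
    ring
  simp only [hterm]
  rw [Finset.sum_sub_distrib, Finset.sum_add_distrib, hone, hone, ← Finset.mul_sum]
  norm_num

section

variable {x y : S d} {θ : ℝ} {t : Fin (d + 1) → ℝ}

theorem mem_absBall_of_hadamard_mem_solidCap (hθ : 0 ≤ θ) (ht : ∀ j, |t j| ≤ 1)
    (hmem : hadamard (y : E d) t ∈ solidCap (x : E d) θ) : y ∈ absBall x θ := by
  refine (mem_absBall hθ).2 fun j => abs_le_of_sq_le_sq ?_ hθ
  have hcos : Real.cos θ ≤ ∑ i, |(x : E d) i * (y : E d) i| :=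
    (hmem.2.trans_eq (inner_hadamard _ _ _)).trans
      (Finset.sum_le_sum fun i _ => mul_le_abs_of_abs_le_one _ (ht i))
  have hterm := Finset.single_le_sum (f := fun i => (|(y : E d) i| - |(x : E d) i|) ^ 2)
    (fun i _ => sq_nonneg _) (Finset.mem_univ j)
  rw [sum_sq_abs_sub_abs] at hterm
  linarith [Real.one_sub_sq_div_two_le_cos (x := θ)]

theorem abs_mul_sub_le_of_hadamard_mem_solidCap (ht : ∀ j, |t j| ≤ 1)
    (hmem : hadamard (y : E d) t ∈ solidCap (x : E d) θ) (j : Fin (d + 1)) :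
    |(x : E d) j * (y : E d) j| - (x : E d) j * (y : E d) j * t j ≤ θ ^ 2 / 2 := by
  have hcos : Real.cos θ ≤ ∑ i, (x : E d) i * (y : E d) i * t i :=
    hmem.2.trans_eq (inner_hadamard _ _ _)
  have hsum : ∑ i, |(x : E d) i * (y : E d) i| ≤ 1 := by
    have hnonneg : 0 ≤ ∑ i, (|(y : E d) i| - |(x : E d) i|) ^ 2 :=
      Finset.sum_nonneg fun i _ => sq_nonneg _
    rw [sum_sq_abs_sub_abs] at hnonneg
    linarith
  have hterm := Finset.single_le_sum
    (f := fun i => |(x : E d) i * (y : E d) i| - (x : E d) i * (y : E d) i * t i)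
    (fun i _ => sub_nonneg.2 (mul_le_abs_of_abs_le_one _ (ht i))) (Finset.mem_univ j)
  rw [Finset.sum_sub_distrib] at hterm
  linarith [Real.one_sub_sq_div_two_le_cos (x := θ)]

end

/-- The size of the kernel on `absBall x θ`, up to constants. -/
def decay (κ : Fin (d + 1) → ℝ) (x : S d) (θ : ℝ) : ℝ :=
  ∏ j, (θ / (|(x : E d) j| + θ)) ^ (2 * κ j)

theorem decay_pos (κ : Fin (d + 1) → ℝ) (x : S d) {θ : ℝ} (hθ : 0 < θ) : 0 < decay κ x θ := by
  unfold decay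
  positivity

theorem ofReal_kernel_eq_zero_of_notMem_absBall (hκ : ∀ j, 0 ≤ κ j) {x y : S d} {θ : ℝ}
    (hθ : 0 ≤ θ) (hy : y ∉ absBall x θ) :
    ENNReal.ofReal (kernel κ (x : E d) θ (y : E d)) = 0 := by
  rw [ofReal_kernel hκ, measure_eq_zero_iff_ae_notMem]
  filter_upwards [ae_cubeMeasure_abs_le_one hκ] with t ht hmem
  exact hy (mem_absBall_of_hadamard_mem_solidCap hθ ht hmem)

theorem exists_kernel_le (hκ : ∀ j, 0 ≤ κ j) :
    ∃ C : ℝ, 0 < C ∧ ∀ (x : S d) (θ : ℝ), 0 < θ → ∀ y ∈ absBall x θ,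
      ENNReal.ofReal (kernel κ (x : E d) θ (y : E d)) ≤ ENNReal.ofReal (C * decay κ x θ) := by
  have := fun j => isProbabilityMeasure_factorMeasure (hκ j)
  choose C hC0 hC using fun j => exists_factorMeasure_abs_sub_le_le (hκ j)
  refine ⟨∏ j, C j, Finset.prod_pos fun j _ => hC0 j, fun x θ hθ y hy => ?_⟩
  calc ENNReal.ofReal (kernel κ (x : E d) θ (y : E d))
      ≤ cubeMeasure κ (Set.univ.pi fun j =>
          {t | |(x : E d) j * (y : E d) j| - (x : E d) j * (y : E d) j * t ≤ θ ^ 2 / 2}) := by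
        rw [ofReal_kernel hκ]
        refine measure_mono_ae ?_
        filter_upwards [ae_cubeMeasure_abs_le_one hκ] with t ht hmem j _
        exact abs_mul_sub_le_of_hadamard_mem_solidCap ht hmem j
    _ ≤ ∏ j, ENNReal.ofReal (C j * (θ / (|(x : E d) j| + θ)) ^ (2 * κ j)) := by
        rw [Measure.pi_pi]
        refine Finset.prod_le_prod' fun j _ => hC j _ _ θ hθ ?_
        rw [abs_sub_comm]
        exact (mem_absBall hθ.le).1 hy j
    _ = ENNReal.ofReal ((∏ j, C j) * decay κ x θ) := by
        rw [decay, ← Finset.prod_mul_distrib,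
          ENNReal.ofReal_prod_of_nonneg fun j _ => mul_nonneg (hC0 j).le (by positivity)]

theorem cos_add_le_inner {F : Type*} [NormedAddCommGroup F] [InnerProductSpace ℝ F] {x y : F}
    (hx : ‖x‖ = 1) (hy : ‖y‖ = 1) {θ : ℝ} (hθ : |θ| ≤ Real.pi)
    (hxy : ‖y - x‖ ≤ 1 / Real.pi * θ) :
    Real.cos θ + 1 / Real.pi ^ 2 * θ ^ 2 ≤ inner ℝ x y := by
  have hpolar := norm_sub_sq_real y x
  rw [hx, hy, real_inner_comm] at hpolar
  have hsq : ‖y - x‖ ^ 2 ≤ 1 / Real.pi ^ 2 * θ ^ 2 :=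
    calc ‖y - x‖ ^ 2 ≤ (1 / Real.pi * θ) ^ 2 := by gcongr
      _ = 1 / Real.pi ^ 2 * θ ^ 2 := by ring
  have hcos := Real.cos_le_one_sub_mul_cos_sq hθ
  have hnonneg : 0 ≤ 1 / Real.pi ^ 2 * θ ^ 2 := by positivity
  have htwo : 2 / Real.pi ^ 2 * θ ^ 2 = 2 * (1 / Real.pi ^ 2 * θ ^ 2) := by ring
  linarith

theorem mul_mul_div_sq_le_sq {u v θ : ℝ} (hθ : 0 < θ) (h : |v - u| ≤ θ) :
    u * v * (θ / (|u| + θ)) ^ 2 ≤ θ ^ 2 := by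
  have hv : |v| ≤ |u| + θ := by linarith [abs_sub_abs_le_abs_sub v u]
  have huv : u * v ≤ (|u| + θ) ^ 2 :=
    calc u * v ≤ |u| * |v| := (le_abs_self _).trans_eq (abs_mul _ _)
      _ ≤ (|u| + θ) * (|u| + θ) := by gcongr; linarith
      _ = (|u| + θ) ^ 2 := by ring
  calc u * v * (θ / (|u| + θ)) ^ 2 ≤ (|u| + θ) ^ 2 * (θ / (|u| + θ)) ^ 2 := by gcongr
    _ = θ ^ 2 := by rw [← mul_pow, mul_div_cancel₀ _ (by positivity)]

theorem hadamard_mem_solidCap {x y : S d} {a θ : ℝ} (ha : 0 ≤ a)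
    (had : (d + 1) * a ≤ 1 / Real.pi ^ 2) (hθ : 0 < θ) (hθπ : θ ≤ Real.pi)
    (hxy : ‖(y : E d) - x‖ ≤ 1 / Real.pi * θ) (hpos : ∀ j, 0 ≤ (x : E d) j * (y : E d) j)
    {t : Fin (d + 1) → ℝ} (ht : ∀ j, |t j| ≤ 1)
    (hta : ∀ j, 1 - a * (θ / (|(x : E d) j| + θ)) ^ 2 ≤ t j) :
    hadamard (y : E d) t ∈ solidCap (x : E d) θ := by
  have hxyj : ∀ j, |(y : E d) j - (x : E d) j| ≤ θ := by
    intro j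
    have hcoord := PiLp.norm_apply_le ((y : E d) - (x : E d)) j
    rw [Real.norm_eq_abs, PiLp.sub_apply] at hcoord
    refine hcoord.trans (hxy.trans (mul_le_of_le_one_left hθ.le ?_))
    rw [div_le_one Real.pi_pos]
    linarith [Real.pi_gt_three]
  have hterm : ∀ j, (x : E d) j * (y : E d) j - a * θ ^ 2 ≤ (x : E d) j * (y : E d) j * t j := by
    intro j
    have hloss := mul_le_mul_of_nonneg_left (mul_mul_div_sq_le_sq hθ (hxyj j)) ha
    have htj := mul_le_mul_of_nonneg_left (hta j) (hpos j)
    linarith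
  refine ⟨(norm_hadamard_le _ ht).trans_eq (norm_eq_of_mem_sphere y), ?_⟩
  calc Real.cos θ ≤ inner ℝ (x : E d) (y : E d) - 1 / Real.pi ^ 2 * θ ^ 2 :=
        le_sub_iff_add_le.2 (cos_add_le_inner (norm_eq_of_mem_sphere x)
          (norm_eq_of_mem_sphere y) (by rwa [abs_of_pos hθ]) hxy)
    _ ≤ inner ℝ (x : E d) (y : E d) - (d + 1) * a * θ ^ 2 := by gcongr
    _ = ∑ j, ((x : E d) j * (y : E d) j - a * θ ^ 2) := by
        rw [Finset.sum_sub_distrib, PiLp.inner_apply]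
        simp only [RCLike.inner_apply, conj_trivial, Finset.sum_const, Finset.card_univ,
          Fintype.card_fin, nsmul_eq_mul, Nat.cast_add, Nat.cast_one, mul_comm,
          mul_left_comm, mul_assoc]
    _ ≤ ∑ j, (x : E d) j * (y : E d) j * t j := Finset.sum_le_sum fun j _ => hterm j
    _ = inner ℝ (x : E d) (hadamard (y : E d) t) := (inner_hadamard _ _ _).symm

theorem exists_le_kernel (hκ : ∀ j, 0 ≤ κ j) :
    ∃ c : ℝ, 0 < c ∧ ∀ (x y : S d), ∀ θ ∈ Set.Ioc 0 Real.pi,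
      ‖(y : E d) - x‖ ≤ 1 / Real.pi * θ → (∀ j, 0 ≤ (x : E d) j * (y : E d) j) →
      ENNReal.ofReal (c * decay κ x θ) ≤ ENNReal.ofReal (kernel κ (x : E d) θ (y : E d)) := by
  have := fun j => isProbabilityMeasure_factorMeasure (hκ j)
  choose c hc0 hc using fun j => exists_le_factorMeasure_Ici (hκ j)
  obtain ⟨a, ha0, ha1, had⟩ : ∃ a : ℝ, 0 < a ∧ a ≤ 1 ∧ (d + 1) * a ≤ 1 / Real.pi ^ 2 := by
    refine ⟨min 1 (1 / Real.pi ^ 2 / (d + 1)), by positivity, min_le_left _ _, ?_⟩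
    rw [← le_div_iff₀' (by positivity)]
    exact min_le_right _ _
  refine ⟨∏ j, c j * a ^ κ j, Finset.prod_pos fun j _ => mul_pos (hc0 j) (by positivity),
    fun x y θ ⟨hθ, hθπ⟩ hxy hpos => ?_⟩
  set q : Fin (d + 1) → ℝ := fun j => θ / (|(x : E d) j| + θ)
  have hq0 : ∀ j, 0 ≤ q j := fun j => by positivity
  have hq1 : ∀ j, q j ≤ 1 := fun j =>
    div_le_one_of_le₀ (le_add_of_nonneg_left (abs_nonneg _)) (by positivity)
  calc ENNReal.ofReal ((∏ j, c j * a ^ κ j) * decay κ x θ)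
      = ∏ j, ENNReal.ofReal (c j * (a * q j ^ 2) ^ κ j) := by
        rw [decay, ← Finset.prod_mul_distrib, ENNReal.ofReal_prod_of_nonneg fun j _ =>
          mul_nonneg (mul_nonneg (hc0 j).le (by positivity)) (by positivity)]
        refine Finset.prod_congr rfl fun j _ => ?_
        rw [Real.mul_rpow ha0.le (sq_nonneg _), ← Real.rpow_two, ← Real.rpow_mul (hq0 j),
          mul_assoc]
    _ ≤ cubeMeasure κ (Set.univ.pi fun j => Set.Ici (1 - a * q j ^ 2)) := by
        rw [Measure.pi_pi]
        exact Finset.prod_le_prod' fun j _ => hc j (a * q j ^ 2) (by positivity)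
          (mul_le_one₀ ha1 (sq_nonneg _) (pow_le_one₀ (hq0 j) (hq1 j)))
    _ ≤ ENNReal.ofReal (kernel κ (x : E d) θ (y : E d)) := by
        rw [ofReal_kernel hκ]
        refine measure_mono_ae ?_
        filter_upwards [ae_cubeMeasure_abs_le_one hκ] with t ht hmem
        exact hadamard_mem_solidCap ha0.le had hθ hθπ hxy hpos ht fun j => hmem j trivial

theorem measurableSet_innerCap (η c : ℝ) (x : S d) (θ : ℝ) :
    MeasurableSet (innerCap η c x θ) := by
  have hinter : innerCap η c x θ = {y : S d | ‖(y : E d) - x‖ ≤ η * θ} ∩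
      ⋂ j, ({y : S d | 0 ≤ (x : E d) j * (y : E d) j} ∩
        {y : S d | c * (|(x : E d) j| + θ) ≤ |(y : E d) j|}) := by
    ext y
    simp [innerCap]
  rw [hinter]
  exact (measurableSet_le (by fun_prop) (by fun_prop)).inter <| MeasurableSet.iInter fun j =>
    (measurableSet_le (by fun_prop) (by fun_prop)).inter
      (measurableSet_le (by fun_prop) (by fun_prop))

theorem le_weight_sq_of_mem_innerCap (hκ : ∀ j, 0 ≤ κ j) {η c θ : ℝ} (hc : 0 ≤ c) (hθ : 0 ≤ θ)
    {x y : S d} (hy : y ∈ innerCap η c x θ) :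
    (∏ j, c ^ (2 * κ j)) * ∏ j, (|(x : E d) j| + θ) ^ (2 * κ j) ≤ weight κ (y : E d) ^ 2 := by
  rw [weight_sq, ← Finset.prod_mul_distrib]
  refine Finset.prod_le_prod (fun j _ => by positivity) fun j _ => ?_
  rw [← Real.mul_rpow hc (by positivity)]
  exact Real.rpow_le_rpow (by positivity) (hy.2 j).2 (by linarith [hκ j])

theorem exists_le_weightedMeasure_innerCap (hκ : ∀ j, 0 ≤ κ j) {η R : ℝ} (hη : 0 < η)
    (hR : 0 ≤ R) :
    ∃ c b : ℝ, 0 < b ∧ ∀ x : S d, ∀ θ ∈ Set.Ioc 0 R,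
      ENNReal.ofReal (b * ballSize κ x θ) ≤ weightedMeasure κ (innerCap η c x θ) := by
  obtain ⟨c, hc0, hc⟩ := exists_le_surface_innerCap d hη hR
  refine ⟨c, (∏ j, c ^ (2 * κ j)) * c, by positivity, fun x θ hθ => ?_⟩
  have hθ0 : 0 < θ := hθ.1
  set w : ℝ := (∏ j, c ^ (2 * κ j)) * ∏ j, (|(x : E d) j| + θ) ^ (2 * κ j)
  calc ENNReal.ofReal ((∏ j, c ^ (2 * κ j)) * c * ballSize κ x θ)
      = ENNReal.ofReal w * ENNReal.ofReal (c * θ ^ d) := by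
        rw [← ENNReal.ofReal_mul (by positivity), ballSize]
        congr 1
        ring
    _ ≤ ENNReal.ofReal w * surface d (innerCap η c x θ) := mul_le_mul_right (hc x θ hθ) _
    _ = ∫⁻ _ in innerCap η c x θ, ENNReal.ofReal w ∂(surface d) := (setLIntegral_const _ _).symm
    _ ≤ ∫⁻ y in innerCap η c x θ, ENNReal.ofReal (weight κ (y : E d) ^ 2) ∂(surface d) :=
        setLIntegral_mono' (measurableSet_innerCap _ _ _ _) fun y hy =>
          ENNReal.ofReal_le_ofReal (le_weight_sq_of_mem_innerCap hκ hc0.le hθ0.le hy)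
    _ = weightedMeasure κ (innerCap η c x θ) :=
        (withDensity_apply _ (measurableSet_innerCap _ _ _ _)).symm

theorem exists_le_lintegral_kernel (hκ : ∀ j, 0 ≤ κ j) :
    ∃ c : ℝ, 0 < c ∧ ∀ x : S d, ∀ θ ∈ Set.Ioc 0 Real.pi,
      ENNReal.ofReal (c * (decay κ x θ * ballSize κ x θ)) ≤
        ∫⁻ y, ENNReal.ofReal (kernel κ (x : E d) θ (y : E d)) ∂(weightedMeasure κ) := by
  obtain ⟨c, b, hb0, hb⟩ :=
    exists_le_weightedMeasure_innerCap hκ (η := 1 / Real.pi) (by positivity) Real.pi_nonneg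
  obtain ⟨a, ha0, ha⟩ := exists_le_kernel hκ
  refine ⟨a * b, by positivity, fun x θ hθ => ?_⟩
  have hdecay := decay_pos κ x hθ.1
  set G := innerCap (1 / Real.pi) c x θ
  calc ENNReal.ofReal (a * b * (decay κ x θ * ballSize κ x θ))
      = ENNReal.ofReal (a * decay κ x θ) * ENNReal.ofReal (b * ballSize κ x θ) := by
        rw [← ENNReal.ofReal_mul (by positivity), mul_mul_mul_comm]
    _ ≤ ENNReal.ofReal (a * decay κ x θ) * weightedMeasure κ G := mul_le_mul_right (hb x θ hθ) _
    _ = ∫⁻ _ in G, ENNReal.ofReal (a * decay κ x θ) ∂(weightedMeasure κ) :=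
        (setLIntegral_const _ _).symm
    _ ≤ ∫⁻ y in G, ENNReal.ofReal (kernel κ (x : E d) θ (y : E d)) ∂(weightedMeasure κ) :=
        setLIntegral_mono' (measurableSet_innerCap _ _ _ _) fun y hy =>
          ha x y θ hθ hy.1 fun j => (hy.2 j).1
    _ ≤ ∫⁻ y, ENNReal.ofReal (kernel κ (x : E d) θ (y : E d)) ∂(weightedMeasure κ) :=
        setLIntegral_le_lintegral _ _

/-- The Hardy–Littlewood maximal function of `h_τ² dω` for the balls `absBall x θ`, with the
explicit `ballSize` in place of their measure. -/
def absMaximal (τ : Fin (d + 1) → ℝ) : (S d → ℝ≥0∞) → S d → ℝ≥0∞ :=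
  ballMaximal (weightedMeasure τ) absCoord (fun x θ => ENNReal.ofReal (ballSize τ x θ)) Real.pi

theorem setLIntegral_absBall_div_le_absMaximal (τ : Fin (d + 1) → ℝ) (g : S d → ℝ≥0∞) (x : S d)
    {θ : ℝ} (hθ : θ ∈ Set.Ioc 0 Real.pi) :
    (∫⁻ y in absBall x θ, g y ∂(weightedMeasure τ)) / ENNReal.ofReal (ballSize τ x θ) ≤
      absMaximal τ g x :=
  le_iSup₂_of_le θ hθ le_rfl

theorem exists_maximal_le_absMaximal (hκ : ∀ j, 0 ≤ κ j) :
    ∃ C : ℝ≥0, C ≠ 0 ∧ ∀ (f : S d → ℝ) (x : S d),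
      maximal κ f x ≤ C * absMaximal κ (fun y => ‖f y‖ₑ) x := by
  obtain ⟨C, hC0, hC⟩ := exists_kernel_le hκ
  obtain ⟨c, hc0, hc⟩ := exists_le_lintegral_kernel hκ
  refine ⟨(C / c).toNNReal, (Real.toNNReal_pos.2 (div_pos hC0 hc0)).ne',
    fun f x => iSup₂_le fun θ hθ => ?_⟩
  have hdecay := decay_pos κ x hθ.1
  have hsize := ballSize_pos κ x hθ.1
  set I := ∫⁻ y in absBall x θ, ‖f y‖ₑ ∂(weightedMeasure κ) with hI
  have hnum :
      ∫⁻ y, ‖f y‖ₑ * ENNReal.ofReal (kernel κ (x : E d) θ (y : E d)) ∂(weightedMeasure κ) ≤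
        I * ENNReal.ofReal (C * decay κ x θ) := by
    rw [hI, ← lintegral_mul_const' _ _ ENNReal.ofReal_ne_top,
      ← lintegral_indicator (measurableSet_absBall _ _)]
    refine lintegral_mono fun y => ?_
    by_cases hy : y ∈ absBall x θ
    · rw [Set.indicator_of_mem hy]
      exact mul_le_mul_right (hC x θ hθ.1 y hy) _
    · rw [ofReal_kernel_eq_zero_of_notMem_absBall hκ hθ.1.le hy, mul_zero]
      exact zero_le
  calc _ ≤ I * ENNReal.ofReal (C * decay κ x θ) /
        ENNReal.ofReal (c * (decay κ x θ * ballSize κ x θ)) :=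
        ENNReal.div_le_div hnum (hc x θ hθ)
    _ = ENNReal.ofReal (C / c) * (I / ENNReal.ofReal (ballSize κ x θ)) := by
        rw [mul_div_assoc, ← ENNReal.ofReal_div_of_pos (by positivity), div_eq_mul_inv I,
          ← ENNReal.ofReal_inv_of_pos hsize, mul_left_comm _ I,
          ← ENNReal.ofReal_mul (by positivity)]
        congr 2
        field_simp
    _ ≤ (C / c).toNNReal * absMaximal κ (fun y => ‖f y‖ₑ) x :=
        mul_le_mul_right (setLIntegral_absBall_div_le_absMaximal κ _ x hθ) _

end Kernel

/-! ### Comparison of the maximal functions for different weights -/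

section Comparison

variable {d : ℕ}

open scoped Pointwise in
theorem ae_surface_ne_zero (d : ℕ) : ∀ᵐ x : S d ∂(surface d), ∀ j, (x : E d) j ≠ 0 := by
  refine ae_all_iff.2 fun j => ?_
  set A : Set (S d) := {x | (x : E d) j = 0}
  suffices hA : surface d A = 0 by simpa only [ae_iff, not_not] using hA
  have hmeas : MeasurableSet A := measurableSet_eq_fun (by fun_prop) (by fun_prop)
  set H : Submodule ℝ (E d) := (EuclideanSpace.proj j : E d →L[ℝ] ℝ).ker
  have hH : H ≠ ⊤ := fun htop => by
    have hsingle : EuclideanSpace.single j (1 : ℝ) ∈ H := htop ▸ Submodule.mem_top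
    simp [H] at hsingle
  have hcone : Set.Ioo (0 : ℝ) 1 • ((↑) '' A) ⊆ (H : Set (E d)) := by
    rintro _ ⟨r, _, _, ⟨x, hx, rfl⟩, rfl⟩
    exact H.smul_mem r hx
  rw [surface, Measure.toSphere_apply' _ hmeas,
    measure_mono_null hcone (Measure.addHaar_submodule _ _ hH), mul_zero]

theorem surface_absolutelyContinuous_weightedMeasure (τ : Fin (d + 1) → ℝ) :
    surface d ≪ weightedMeasure τ := by
  refine withDensity_absolutelyContinuous' (by fun_prop) ?_
  filter_upwards [ae_surface_ne_zero d] with x hx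
  rw [ne_eq, ENNReal.ofReal_eq_zero, not_le, weight_sq]
  exact Finset.prod_pos fun j _ => Real.rpow_pos_of_pos (abs_pos.2 (hx j)) _

theorem setLIntegral_weightedMeasure (τ : Fin (d + 1) → ℝ) (g : S d → ℝ≥0∞) {A : Set (S d)}
    (hA : MeasurableSet A) :
    ∫⁻ y in A, g y ∂(weightedMeasure τ) =
      ∫⁻ y in A, ENNReal.ofReal (weight τ (y : E d) ^ 2) * g y ∂(surface d) := by
  rw [weightedMeasure, setLIntegral_withDensity_eq_setLIntegral_mul_non_measurable _
    (by fun_prop) _ hA (ae_of_all _ fun _ => ENNReal.ofReal_lt_top)]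
  rfl

theorem ballSize_eq_mul_ballSize (κ τ : Fin (d + 1) → ℝ) (x : S d) {θ : ℝ} (hθ : 0 < θ) :
    ballSize κ x θ = (∏ j, (|(x : E d) j| + θ) ^ (2 * (κ j - τ j))) * ballSize τ x θ := by
  rw [ballSize, ballSize, mul_left_comm, ← Finset.prod_mul_distrib]
  congr! 2 with j
  rw [← Real.rpow_add (by positivity)]
  ring_nf

theorem weight_sq_le_mul_weight_sq {κ τ : Fin (d + 1) → ℝ} (hτκ : ∀ j, τ j ≤ κ j) {y : E d}
    {b : Fin (d + 1) → ℝ} (hy : ∀ j, y j ≠ 0) (hyb : ∀ j, |y j| ≤ b j) :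
    weight κ y ^ 2 ≤ (∏ j, b j ^ (2 * (κ j - τ j))) * weight τ y ^ 2 := by
  rw [weight_sq, weight_sq, ← Finset.prod_mul_distrib]
  refine Finset.prod_le_prod (fun j _ => by positivity) fun j _ => ?_
  calc |y j| ^ (2 * κ j) = |y j| ^ (2 * (κ j - τ j)) * |y j| ^ (2 * τ j) := by
        rw [← Real.rpow_add (abs_pos.2 (hy j))]
        ring_nf
    _ ≤ b j ^ (2 * (κ j - τ j)) * |y j| ^ (2 * τ j) := by
        gcongr
        · linarith [hτκ j]
        · exact hyb j

theorem absMaximal_le_of_le {κ τ : Fin (d + 1) → ℝ} (hτκ : ∀ j, τ j ≤ κ j) (g : S d → ℝ≥0∞)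
    (x : S d) : absMaximal κ g x ≤ absMaximal τ g x := by
  refine iSup₂_le fun θ hθ => le_trans ?_ (setLIntegral_absBall_div_le_absMaximal τ g x hθ)
  set P := ∏ j, (|(x : E d) j| + θ) ^ (2 * (κ j - τ j))
  have hP : 0 < P :=
    Finset.prod_pos fun j _ => Real.rpow_pos_of_pos (add_pos_of_nonneg_of_pos (abs_nonneg _) hθ.1) _
  have hint : ∫⁻ y in absBall x θ, g y ∂(weightedMeasure κ) ≤
      ENNReal.ofReal P * ∫⁻ y in absBall x θ, g y ∂(weightedMeasure τ) := by
    rw [setLIntegral_weightedMeasure κ g (measurableSet_absBall _ _),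
      setLIntegral_weightedMeasure τ g (measurableSet_absBall _ _),
      ← lintegral_const_mul' _ _ ENNReal.ofReal_ne_top]
    refine setLIntegral_mono_ae' (measurableSet_absBall _ _) ?_
    filter_upwards [ae_surface_ne_zero d] with y hy hmem
    rw [← mul_assoc, ← ENNReal.ofReal_mul hP.le]
    refine mul_le_mul_left (ENNReal.ofReal_le_ofReal (weight_sq_le_mul_weight_sq hτκ hy ?_)) _
    exact fun j => by linarith [(abs_le.1 ((mem_absBall hθ.1.le).1 hmem j)).2]
  calc (∫⁻ y in absBall x θ, g y ∂(weightedMeasure κ)) / ENNReal.ofReal (ballSize κ x θ)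
      ≤ ENNReal.ofReal P * (∫⁻ y in absBall x θ, g y ∂(weightedMeasure τ)) /
          (ENNReal.ofReal P * ENNReal.ofReal (ballSize τ x θ)) := by
        rw [ballSize_eq_mul_ballSize κ τ x hθ.1, ENNReal.ofReal_mul hP.le]
        exact ENNReal.div_le_div_right hint _
    _ = (∫⁻ y in absBall x θ, g y ∂(weightedMeasure τ)) / ENNReal.ofReal (ballSize τ x θ) :=
        ENNReal.mul_div_mul_left _ _ (by simpa using hP) ENNReal.ofReal_ne_top

theorem prod_rpow_rpow_mul_prod_rpow_rpow {ι : Type*} (s : Finset ι) {z : ι → ℝ}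
    (hz : ∀ j, 0 < z j) (σ τ : ι → ℝ) (a b : ℝ) :
    (∏ j ∈ s, z j ^ (2 * σ j)) ^ a * (∏ j ∈ s, z j ^ (2 * τ j)) ^ b =
      ∏ j ∈ s, z j ^ (2 * (a * σ j + b * τ j)) := by
  rw [← Real.finsetProd_rpow _ _ fun j _ => Real.rpow_nonneg (hz j).le _,
    ← Real.finsetProd_rpow _ _ fun j _ => Real.rpow_nonneg (hz j).le _, ← Finset.prod_mul_distrib]
  refine Finset.prod_congr rfl fun j _ => ?_
  rw [← Real.rpow_mul (hz j).le, ← Real.rpow_mul (hz j).le, ← Real.rpow_add (hz j)]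
  ring_nf

theorem ballSize_rpow_mul_ballSize_rpow (σ τ : Fin (d + 1) → ℝ) {a b : ℝ} (hab : a + b = 1)
    (x : S d) {θ : ℝ} (hθ : 0 < θ) :
    ballSize σ x θ ^ a * ballSize τ x θ ^ b = ballSize (fun j => a * σ j + b * τ j) x θ := by
  have hθd : 0 < θ ^ d := pow_pos hθ d
  rw [ballSize, ballSize, ballSize, Real.mul_rpow hθd.le (by positivity),
    Real.mul_rpow hθd.le (by positivity), mul_mul_mul_comm, ← Real.rpow_add hθd, hab,
    Real.rpow_one, prod_rpow_rpow_mul_prod_rpow_rpow _ fun j => by positivity]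

theorem weight_sq_rpow_mul_weight_sq_rpow (σ τ : Fin (d + 1) → ℝ) (a b : ℝ) {y : E d}
    (hy : ∀ j, y j ≠ 0) :
    (weight σ y ^ 2) ^ a * (weight τ y ^ 2) ^ b =
      weight (fun j => a * σ j + b * τ j) y ^ 2 := by
  rw [weight_sq, weight_sq, weight_sq,
    prod_rpow_rpow_mul_prod_rpow_rpow _ fun j => abs_pos.2 (hy j)]

theorem lintegral_mul_rpow_mul_rpow_le {α : Type*} [MeasurableSpace α] (μ : Measure α) {p q : ℝ}
    (hpq : p.HolderConjugate q) {g u v : α → ℝ≥0∞} (hg : AEMeasurable g μ)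
    (hu : AEMeasurable u μ) (hv : AEMeasurable v μ) :
    ∫⁻ y, u y ^ (1 / p) * v y ^ (1 / q) * g y ∂μ ≤
      (∫⁻ y, u y * g y ^ p ∂μ) ^ (1 / p) * (∫⁻ y, v y ∂μ) ^ (1 / q) := by
  have hcancel : ∀ {r : ℝ}, 0 < r → ∀ w : ℝ≥0∞, (w ^ (1 / r)) ^ r = w := fun hr w => by
    rw [← ENNReal.rpow_mul, one_div_mul_cancel hr.ne', ENNReal.rpow_one]
  calc ∫⁻ y, u y ^ (1 / p) * v y ^ (1 / q) * g y ∂μ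
      = ∫⁻ y, (u y ^ (1 / p) * g y) * v y ^ (1 / q) ∂μ := by simp only [mul_right_comm]
    _ ≤ (∫⁻ y, (u y ^ (1 / p) * g y) ^ p ∂μ) ^ (1 / p) *
          (∫⁻ y, (v y ^ (1 / q)) ^ q ∂μ) ^ (1 / q) :=
        ENNReal.lintegral_mul_le_Lp_mul_Lq μ hpq ((hu.pow_const _).mul hg) (hv.pow_const _)
    _ = (∫⁻ y, u y * g y ^ p ∂μ) ^ (1 / p) * (∫⁻ y, v y ∂μ) ^ (1 / q) := by
        simp only [ENNReal.mul_rpow_of_nonneg _ _ hpq.nonneg, hcancel hpq.pos,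
          hcancel hpq.symm.pos]

theorem setLIntegral_weightedMeasure_le_rpow_mul_rpow (τ σ : Fin (d + 1) → ℝ) {p q : ℝ}
    (hpq : p.HolderConjugate q) {g : S d → ℝ≥0∞} (hg : Measurable g) {A : Set (S d)}
    (hA : MeasurableSet A) :
    ∫⁻ y in A, g y ∂(weightedMeasure fun j => 1 / p * τ j + 1 / q * σ j) ≤
      (∫⁻ y in A, g y ^ p ∂(weightedMeasure τ)) ^ (1 / p) * weightedMeasure σ A ^ (1 / q) := by
  have hsplit : ∀ᵐ y : S d ∂(surface d),
      ENNReal.ofReal (weight (fun j => 1 / p * τ j + 1 / q * σ j) (y : E d) ^ 2) * g y =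
        ENNReal.ofReal (weight τ (y : E d) ^ 2) ^ (1 / p) *
          ENNReal.ofReal (weight σ (y : E d) ^ 2) ^ (1 / q) * g y := by
    filter_upwards [ae_surface_ne_zero d] with y hy
    rw [← weight_sq_rpow_mul_weight_sq_rpow τ σ _ _ hy, ENNReal.ofReal_mul (by positivity),
      ENNReal.ofReal_rpow_of_nonneg (sq_nonneg _) hpq.one_div_nonneg,
      ENNReal.ofReal_rpow_of_nonneg (sq_nonneg _) hpq.symm.one_div_nonneg]
  rw [setLIntegral_weightedMeasure _ _ hA, setLIntegral_weightedMeasure _ _ hA,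
    lintegral_congr_ae (ae_restrict_of_ae hsplit), weightedMeasure, withDensity_apply _ hA]
  exact lintegral_mul_rpow_mul_rpow_le _ hpq hg.aemeasurable (by fun_prop) (by fun_prop)

theorem ofReal_ballSize_eq_rpow_mul_rpow (τ σ : Fin (d + 1) → ℝ) {p q : ℝ}
    (hpq : p.HolderConjugate q) (x : S d) {θ : ℝ} (hθ : 0 < θ) :
    ENNReal.ofReal (ballSize (fun j => 1 / p * τ j + 1 / q * σ j) x θ) =
      ENNReal.ofReal (ballSize τ x θ) ^ (1 / p) * ENNReal.ofReal (ballSize σ x θ) ^ (1 / q) := by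
  have hτ := ballSize_pos τ x hθ
  have hadd : 1 / p + 1 / q = 1 := by simpa only [one_div] using hpq.inv_add_inv_eq_one
  rw [← ballSize_rpow_mul_ballSize_rpow τ σ hadd x hθ, ENNReal.ofReal_mul (by positivity),
    ENNReal.ofReal_rpow_of_nonneg hτ.le hpq.one_div_nonneg,
    ENNReal.ofReal_rpow_of_nonneg (ballSize_pos σ x hθ).le hpq.symm.one_div_nonneg]

theorem exists_absMaximal_add_le_rpow (τ : Fin (d + 1) → ℝ) {σ : Fin (d + 1) → ℝ}
    (hσ : ∀ j, -(1 / 2 : ℝ) < σ j) {p q : ℝ} (hpq : p.HolderConjugate q) :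
    ∃ C : ℝ≥0, ∀ g : S d → ℝ≥0∞, Measurable g → ∀ x : S d,
      absMaximal (fun j => 1 / p * τ j + 1 / q * σ j) g x ≤
        C * absMaximal τ (fun y => g y ^ p) x ^ (1 / p) := by
  obtain ⟨C, -, hC⟩ := exists_weightedMeasure_absBall_le hσ le_rfl Real.pi_nonneg
  refine ⟨C ^ (1 / q), fun g hg x => iSup₂_le fun θ hθ => ?_⟩
  have hp : 0 ≤ 1 / p := hpq.one_div_nonneg
  have hq : 0 ≤ 1 / q := hpq.symm.one_div_nonneg
  set I := ∫⁻ y in absBall x θ, g y ^ p ∂(weightedMeasure τ)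
  set s := ENNReal.ofReal (ballSize σ x θ) ^ (1 / q) with hsdef
  have hs0 : s ≠ 0 := by simp [s, ENNReal.rpow_eq_zero_iff, ballSize_pos σ x hθ.1]
  have hs : s ≠ ∞ := ENNReal.rpow_ne_top_of_nonneg hq ENNReal.ofReal_ne_top
  have hball : weightedMeasure σ (absBall x θ) ^ (1 / q) ≤ (C ^ (1 / q) : ℝ≥0) * s := by
    rw [ENNReal.coe_rpow_of_nonneg _ hq, hsdef, ← ENNReal.mul_rpow_of_nonneg _ _ hq]
    exact ENNReal.rpow_le_rpow (by simpa only [one_mul] using hC x θ hθ) hq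
  have hint : ∫⁻ y in absBall x θ, g y ∂(weightedMeasure fun j => 1 / p * τ j + 1 / q * σ j) ≤
      (C ^ (1 / q) : ℝ≥0) * I ^ (1 / p) * s :=
    calc _ ≤ I ^ (1 / p) * weightedMeasure σ (absBall x θ) ^ (1 / q) :=
          setLIntegral_weightedMeasure_le_rpow_mul_rpow τ σ hpq hg (measurableSet_absBall x θ)
      _ ≤ I ^ (1 / p) * ((C ^ (1 / q) : ℝ≥0) * s) := mul_le_mul_right hball _
      _ = (C ^ (1 / q) : ℝ≥0) * I ^ (1 / p) * s := by ring
  calc _ ≤ (C ^ (1 / q) : ℝ≥0) * I ^ (1 / p) * s /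
          (ENNReal.ofReal (ballSize τ x θ) ^ (1 / p) * s) :=
        ENNReal.div_le_div hint (ofReal_ballSize_eq_rpow_mul_rpow τ σ hpq x hθ.1).ge
    _ = (C ^ (1 / q) : ℝ≥0) * (I / ENNReal.ofReal (ballSize τ x θ)) ^ (1 / p) := by
        rw [ENNReal.mul_div_mul_right _ _ hs0 hs, mul_div_assoc,
          ENNReal.div_rpow_of_nonneg _ _ hp]
    _ ≤ (C ^ (1 / q) : ℝ≥0) * absMaximal τ (fun y => g y ^ p) x ^ (1 / p) :=
        mul_le_mul_right (ENNReal.rpow_le_rpow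
          (setLIntegral_absBall_div_le_absMaximal τ _ x hθ) hp) _

theorem exists_absMaximal_le_rpow {κ τ : Fin (d + 1) → ℝ} {p : ℝ} (hp : 1 < p)
    (hτκ : ∀ j, τ j < p * κ j + (p - 1) / 2) :
    ∃ C : ℝ≥0, ∀ g : S d → ℝ≥0∞, Measurable g → ∀ x : S d,
      absMaximal κ g x ≤ C * absMaximal τ (fun y => g y ^ p) x ^ (1 / p) := by
  have hpq : p.HolderConjugate p.conjExponent := .conjExponent hp
  have hp1 : 0 < p - 1 := sub_pos.2 hp
  set σ : Fin (d + 1) → ℝ := fun j => (p * κ j - τ j) / (p - 1)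
  have hσ : ∀ j, -(1 / 2 : ℝ) < σ j := fun j => by
    rw [lt_div_iff₀ hp1]
    linarith [hτκ j]
  have hκ : (fun j => 1 / p * τ j + 1 / p.conjExponent * σ j) = κ := by
    funext j
    simp only [σ, Real.conjExponent]
    field_simp [hp1.ne']
    ring
  simpa only [hκ] using exists_absMaximal_add_le_rpow τ hσ hpq

end Comparison

/-! ### Measurability of the maximal function -/

section Measurability

open Filter Topology

theorem iSup_Ioc_eq_iSup_rat {G : ℝ → ℝ≥0∞} {a b : ℝ}
    (hG : ∀ θ ∈ Set.Ioo a b, LowerSemicontinuousWithinAt G (Set.Ioi θ) θ) :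
    ⨆ θ ∈ Set.Ioc a b, G θ =
      ⨆ θ ∈ insert b (Set.range ((↑) : ℚ → ℝ)) ∩ Set.Ioc a b, G θ := by
  refine le_antisymm (iSup₂_le fun θ hθ => ?_) (biSup_mono fun θ hθ => hθ.2)
  rcases hθ.2.eq_or_lt with rfl | hlt
  · exact le_iSup₂_of_le θ ⟨Set.mem_insert _ _, hθ⟩ le_rfl
  refine le_of_forall_lt fun l hl => ?_
  obtain ⟨u, hu, hsub⟩ := mem_nhdsGT_iff_exists_Ioo_subset.1
    ((hG θ ⟨hθ.1, hlt⟩ l hl).and (Ioo_mem_nhdsGT hlt))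
  obtain ⟨q, hθq, hqu⟩ := exists_rat_btwn (show θ < u from hu)
  obtain ⟨hlq, -, hqb⟩ := hsub ⟨hθq, hqu⟩
  exact hlq.trans_le (le_iSup₂_of_le (q : ℝ)
    ⟨Set.mem_insert_of_mem _ ⟨q, rfl⟩, hθ.1.trans hθq, hqb.le⟩ le_rfl)

variable {d : ℕ} {κ : Fin (d + 1) → ℝ}

theorem isFiniteMeasure_weightedMeasure (hκ : ∀ j, 0 ≤ κ j) :
    IsFiniteMeasure (weightedMeasure κ) := by
  have hweight : ∀ x : S d, ENNReal.ofReal (weight κ (x : E d) ^ 2) ≤ 1 := fun x => by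
    rw [ENNReal.ofReal_le_one, weight_sq]
    exact Finset.prod_le_one (fun j _ => by positivity) fun j _ =>
      Real.rpow_le_one (abs_nonneg _) (abs_apply_le_one x j) (by linarith [hκ j])
  have hle : weightedMeasure κ ≤ surface d :=
    (withDensity_mono (ae_of_all _ hweight)).trans_eq withDensity_one
  exact isFiniteMeasure_of_le _ hle

theorem solidCap_subset_solidCap (x : E d) {θ θ' : ℝ} (hθ : 0 ≤ θ) (hθθ' : θ ≤ θ')
    (hθ' : θ' ≤ Real.pi) : solidCap x θ ⊆ solidCap x θ' :=
  fun _ hz => ⟨hz.1, (Real.cos_le_cos_of_nonneg_of_le_pi hθ hθ' hθθ').trans hz.2⟩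

theorem eventually_mem_solidCap_iff (x z : E d) {θ : ℝ} (hθ : θ ∈ Set.Ico 0 Real.pi) :
    ∀ᶠ θ' in 𝓝[>] θ, z ∈ solidCap x θ' ↔ z ∈ solidCap x θ := by
  by_cases hz : z ∈ solidCap x θ
  · filter_upwards [Ioo_mem_nhdsGT hθ.2] with θ' hθ'
    exact iff_of_true (solidCap_subset_solidCap x hθ.1 hθ'.1.le hθ'.2.le hz) hz
  by_cases hnorm : ‖z‖ ≤ 1
  · have hinner : inner ℝ x z < Real.cos θ := not_le.1 fun h => hz ⟨hnorm, h⟩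
    filter_upwards [(Real.continuous_cos.continuousAt.eventually
      (lt_mem_nhds hinner)).filter_mono nhdsWithin_le_nhds] with θ' hθ'
    exact iff_of_false (fun h => hθ'.not_ge h.2) hz
  · exact .of_forall fun θ' => iff_of_false (fun h => hnorm h.1) hz

theorem ofReal_kernel_mono (hκ : ∀ j, 0 ≤ κ j) (x y : E d) {θ θ' : ℝ} (hθ : 0 ≤ θ)
    (hθθ' : θ ≤ θ') (hθ' : θ' ≤ Real.pi) :
    ENNReal.ofReal (kernel κ x θ y) ≤ ENNReal.ofReal (kernel κ x θ' y) := by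
  rw [ofReal_kernel hκ, ofReal_kernel hκ]
  exact measure_mono (Set.preimage_mono (solidCap_subset_solidCap x hθ hθθ' hθ'))

theorem ofReal_kernel_le_one (hκ : ∀ j, 0 ≤ κ j) (x y : E d) (θ : ℝ) :
    ENNReal.ofReal (kernel κ x θ y) ≤ 1 := by
  have := isProbabilityMeasure_cubeMeasure hκ
  rw [ofReal_kernel hκ]
  exact prob_le_one

theorem tendsto_ofReal_kernel_nhdsGT (hκ : ∀ j, 0 ≤ κ j) (x y : E d) {θ : ℝ}
    (hθ : θ ∈ Set.Ico 0 Real.pi) :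
    Tendsto (fun θ' => ENNReal.ofReal (kernel κ x θ' y)) (𝓝[>] θ)
      (𝓝 (ENNReal.ofReal (kernel κ x θ y))) := by
  have := isProbabilityMeasure_cubeMeasure hκ
  have hhadamard : Measurable (hadamard y) := by unfold hadamard; fun_prop
  simp only [ofReal_kernel hκ]
  exact tendsto_measure_of_tendsto_indicator_of_isFiniteMeasure _ _
    (fun θ' => hhadamard (isClosed_solidCap x θ').measurableSet)
    fun t => eventually_mem_solidCap_iff x (hadamard y t) hθ

theorem measurable_ofReal_kernel (hκ : ∀ j, 0 ≤ κ j) (θ : ℝ) :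
    Measurable fun p : S d × S d => ENNReal.ofReal (kernel κ (p.1 : E d) θ (p.2 : E d)) := by
  have := isProbabilityMeasure_cubeMeasure hκ
  have hhadamard : Measurable fun p : (S d × S d) × (Fin (d + 1) → ℝ) =>
      hadamard (p.1.2 : E d) p.2 := by unfold hadamard; fun_prop
  have hnorm : MeasurableSet {p : (S d × S d) × (Fin (d + 1) → ℝ) |
      ‖hadamard (p.1.2 : E d) p.2‖ ≤ 1} := measurableSet_le hhadamard.norm measurable_const
  have hinner : MeasurableSet {p : (S d × S d) × (Fin (d + 1) → ℝ) |
      Real.cos θ ≤ inner ℝ (p.1.1 : E d) (hadamard (p.1.2 : E d) p.2)} :=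
    measurableSet_le measurable_const (Measurable.inner (by fun_prop) hhadamard)
  simp only [ofReal_kernel hκ]
  exact measurable_measure_prodMk_left (hnorm.inter hinner)

theorem measurable_ofReal_kernel_right (hκ : ∀ j, 0 ≤ κ j) (x : S d) (θ : ℝ) :
    Measurable fun y : S d => ENNReal.ofReal (kernel κ (x : E d) θ (y : E d)) := by
  have hpair : Measurable (Prod.mk x : S d → S d × S d) := measurable_prodMk_left
  have hcomp := (measurable_ofReal_kernel hκ θ).comp hpair
  simpa only [Function.comp_def] using hcomp

theorem tendsto_lintegral_kernel_nhdsGT (hκ : ∀ j, 0 ≤ κ j) (x : S d) {θ : ℝ}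
    (hθ : θ ∈ Set.Ico 0 Real.pi) :
    Tendsto
      (fun θ' => ∫⁻ y, ENNReal.ofReal (kernel κ (x : E d) θ' (y : E d)) ∂(weightedMeasure κ))
      (𝓝[>] θ)
      (𝓝 (∫⁻ y, ENNReal.ofReal (kernel κ (x : E d) θ (y : E d)) ∂(weightedMeasure κ))) := by
  have := isFiniteMeasure_weightedMeasure hκ
  refine tendsto_lintegral_filter_of_dominated_convergence (fun _ => 1)
    (.of_forall (measurable_ofReal_kernel_right hκ x))
    (.of_forall fun θ' => ae_of_all _ fun y => ofReal_kernel_le_one hκ _ _ _) ?_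
    (ae_of_all _ fun y => tendsto_ofReal_kernel_nhdsGT hκ _ _ hθ)
  rw [lintegral_one]
  exact measure_ne_top _ _

theorem lintegral_kernel_ne_top (hκ : ∀ j, 0 ≤ κ j) (x : S d) (θ : ℝ) :
    ∫⁻ y, ENNReal.ofReal (kernel κ (x : E d) θ (y : E d)) ∂(weightedMeasure κ) ≠ ∞ := by
  have := isFiniteMeasure_weightedMeasure hκ
  refine ne_top_of_le_ne_top (measure_ne_top (weightedMeasure κ) Set.univ) ?_
  rw [← lintegral_one]
  exact lintegral_mono fun y => ofReal_kernel_le_one hκ _ _ _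

/-- The average of `|f|` against `V_κ[χ_{B(x,θ)}] h_κ² dω`, so that `maximal κ f x` is its
supremum over `0 < θ ≤ π`. -/
def average (κ : Fin (d + 1) → ℝ) (f : S d → ℝ) (x : S d) (θ : ℝ) : ℝ≥0∞ :=
  (∫⁻ y, ‖f y‖ₑ * ENNReal.ofReal (kernel κ (x : E d) θ (y : E d)) ∂(weightedMeasure κ)) /
    (∫⁻ y, ENNReal.ofReal (kernel κ (x : E d) θ (y : E d)) ∂(weightedMeasure κ))

theorem measurable_average (hκ : ∀ j, 0 ≤ κ j) {f : S d → ℝ} (hf : Measurable f) (θ : ℝ) :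
    Measurable fun x => average κ f x θ := by
  have := isFiniteMeasure_weightedMeasure hκ
  have hkernel := measurable_ofReal_kernel hκ θ
  exact ((hf.comp measurable_snd).enorm.mul hkernel).lintegral_prod_right'.div
    hkernel.lintegral_prod_right'

-- In the direction `θ' ↓ θ` the numerator only increases and the denominator is continuous.
theorem lowerSemicontinuousWithinAt_average (hκ : ∀ j, 0 ≤ κ j) (f : S d → ℝ) (x : S d) {θ : ℝ}
    (hθ : θ ∈ Set.Ico 0 Real.pi) :
    LowerSemicontinuousWithinAt (average κ f x) (Set.Ioi θ) θ := by
  intro l hl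
  have htendsto := ENNReal.Tendsto.const_div
    (a := ∫⁻ y, ‖f y‖ₑ * ENNReal.ofReal (kernel κ (x : E d) θ (y : E d)) ∂(weightedMeasure κ))
    (tendsto_lintegral_kernel_nhdsGT hκ x hθ) (.inl (lintegral_kernel_ne_top hκ x θ))
  filter_upwards [htendsto.eventually (lt_mem_nhds hl), Ioo_mem_nhdsGT hθ.2] with θ' hlθ' hθ'
  refine hlθ'.trans_le (ENNReal.div_le_div_right (lintegral_mono fun y => ?_) _)
  exact mul_le_mul_right (ofReal_kernel_mono hκ _ _ hθ.1 hθ'.1.le hθ'.2.le) _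

theorem measurable_maximal (hκ : ∀ j, 0 ≤ κ j) {f : S d → ℝ} (hf : Measurable f) :
    Measurable (maximal κ f) := by
  have hcountable : maximal κ f = fun x =>
      ⨆ θ ∈ insert Real.pi (Set.range ((↑) : ℚ → ℝ)) ∩ Set.Ioc 0 Real.pi, average κ f x θ :=
    funext fun x => iSup_Ioc_eq_iSup_rat fun θ hθ =>
      lowerSemicontinuousWithinAt_average hκ f x ⟨hθ.1.le, hθ.2⟩
  rw [hcountable]
  exact Measurable.biSup _ (((Set.countable_range _).insert _).mono Set.inter_subset_left)
    fun θ _ => measurable_average hκ hf θ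

end Measurability

/-! ### Weak and strong type estimates -/

section Estimates

variable {d : ℕ} {κ τ : Fin (d + 1) → ℝ}

theorem maximal_congr_ae {f g : S d → ℝ} (h : f =ᵐ[surface d] g) :
    maximal κ f = maximal κ g := by
  funext x
  unfold maximal
  congr! 4 with θ
  refine lintegral_congr_ae ?_
  filter_upwards [(withDensity_absolutelyContinuous _ _).ae_le h] with y hy
  rw [hy]

theorem maximal_le_of_ae_le (hκ : ∀ j, 0 ≤ κ j) {f : S d → ℝ} {a : ℝ≥0∞}
    (h : ∀ᵐ y ∂(surface d), ‖f y‖ₑ ≤ a) (x : S d) : maximal κ f x ≤ a := by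
  refine iSup₂_le fun θ _ => ENNReal.div_le_of_le_mul ?_
  rw [← lintegral_const_mul _ (measurable_ofReal_kernel_right hκ x θ)]
  refine lintegral_mono_ae ?_
  filter_upwards [(withDensity_absolutelyContinuous _ _).ae_le h] with y hy
  exact mul_le_mul_left hy _

theorem exists_mul_measure_le_absMaximal_le (hτ : ∀ j, -(1 / 2 : ℝ) < τ j) :
    ∃ C : ℝ≥0, ∀ (g : S d → ℝ≥0∞) (l : ℝ≥0∞),
      l * weightedMeasure τ {x | l ≤ absMaximal τ g x} ≤ C * ∫⁻ y, g y ∂(weightedMeasure τ) := by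
  obtain ⟨C, hC0, hC⟩ := exists_weightedMeasure_absBall_le hτ (by norm_num : (1 : ℝ) ≤ 5)
    Real.pi_nonneg
  exact ⟨C, fun g => mul_measure_le_of_forall_mul_measure_lt_le
    (mul_measure_lt_ballMaximal_le measurable_absCoord hC0 hC g)⟩

theorem exists_lintegral_absMaximal_rpow_le (hτ : ∀ j, -(1 / 2 : ℝ) < τ j) {s : ℝ}
    (hs : 1 < s) :
    ∃ C : ℝ≥0, ∀ g : S d → ℝ≥0∞, Measurable g →
      ∫⁻ x, absMaximal τ g x ^ s ∂(weightedMeasure τ) ≤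
        C * ∫⁻ x, g x ^ s ∂(weightedMeasure τ) := by
  obtain ⟨C, hC0, hC⟩ := exists_weightedMeasure_absBall_le hτ (by norm_num : (1 : ℝ) ≤ 5)
    Real.pi_nonneg
  have : SFinite (weightedMeasure τ) := by unfold weightedMeasure; infer_instance
  have hbound := fun g (hg : Measurable g) =>
    lintegral_ballMaximal_rpow_le measurable_absCoord hC0 hC hg hs
  have hfinite : ENNReal.ofReal s / ENNReal.ofReal (s - 1) * ((2 * C : ℝ≥0) : ℝ≥0∞) ^ s ≠ ∞ :=
    ENNReal.mul_ne_top (ENNReal.div_ne_top ENNReal.ofReal_ne_top (by simpa using hs))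
      (ENNReal.rpow_ne_top_of_nonneg (by linarith) ENNReal.coe_ne_top)
  lift ENNReal.ofReal s / ENNReal.ofReal (s - 1) * ((2 * C : ℝ≥0) : ℝ≥0∞) ^ s to ℝ≥0
    using hfinite with D
  exact ⟨D, hbound⟩

theorem exists_weightedMeasure_le_maximal_le (hκ : ∀ j, 0 ≤ κ j)
    (hτ : ∀ j, -(1 / 2 : ℝ) < τ j) (hτκ : ∀ j, τ j ≤ κ j) :
    ∃ c : ℝ≥0, ∀ (f : S d → ℝ) (α : ℝ), 0 < α →
      weightedMeasure τ {x | ENNReal.ofReal α ≤ maximal κ f x} ≤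
        c * eLpNorm f 1 (weightedMeasure τ) / ENNReal.ofReal α := by
  obtain ⟨A, hA0, hA⟩ := exists_maximal_le_absMaximal hκ
  obtain ⟨C, hC⟩ := exists_mul_measure_le_absMaximal_le hτ
  refine ⟨A * C, fun f α hα => ?_⟩
  set l : ℝ≥0∞ := ENNReal.ofReal α / A
  have hsub : {x | ENNReal.ofReal α ≤ maximal κ f x} ⊆
      {x | l ≤ absMaximal τ (fun y => ‖f y‖ₑ) x} := fun x hx =>
    (ENNReal.div_le_of_le_mul' (hx.trans (hA f x))).trans (absMaximal_le_of_le hτκ _ x)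
  have hl : ENNReal.ofReal α = A * l :=
    (ENNReal.mul_div_cancel (ENNReal.coe_ne_zero.2 hA0) ENNReal.coe_ne_top).symm
  rw [ENNReal.le_div_iff_mul_le (.inl (by simpa using hα)) (.inl ENNReal.ofReal_ne_top),
    eLpNorm_one_eq_lintegral_enorm, mul_comm]
  calc ENNReal.ofReal α * weightedMeasure τ {x | ENNReal.ofReal α ≤ maximal κ f x}
      ≤ A * l * weightedMeasure τ {x | l ≤ absMaximal τ (fun y => ‖f y‖ₑ) x} :=
        mul_le_mul' hl.le (measure_mono hsub)
    _ ≤ A * (C * ∫⁻ y, ‖f y‖ₑ ∂(weightedMeasure τ)) := by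
        rw [mul_assoc]
        exact mul_le_mul_right (hC _ l) _
    _ = (A * C : ℝ≥0) * ∫⁻ y, ‖f y‖ₑ ∂(weightedMeasure τ) := by
        rw [ENNReal.coe_mul, mul_assoc]

theorem exists_exponent_lt {p : ℝ} (hp : 1 < p) (h : ∀ j, τ j < p * κ j + (p - 1) / 2) :
    ∃ q, 1 < q ∧ q < p ∧ ∀ j, τ j < q * κ j + (q - 1) / 2 := by
  have hnear : ∀ᶠ q in nhdsWithin p (Set.Iio p), ∀ j, τ j < q * κ j + (q - 1) / 2 := by
    refine Filter.eventually_all.2 fun j => ?_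
    have hcont : Continuous fun q : ℝ => q * κ j + (q - 1) / 2 := by fun_prop
    exact (hcont.continuousAt.eventually (lt_mem_nhds (h j))).filter_mono nhdsWithin_le_nhds
  obtain ⟨q, hq, hq1, hqp⟩ := (hnear.and (Ioo_mem_nhdsLT hp)).exists
  exact ⟨q, hq1, hqp, hq⟩

theorem exists_lintegral_maximal_rpow_le (hκ : ∀ j, 0 ≤ κ j) (hτ : ∀ j, -(1 / 2 : ℝ) < τ j)
    {p : ℝ} (hp : 1 < p) (hτκ : ∀ j, τ j < p * κ j + (p - 1) / 2) :
    ∃ c : ℝ≥0, ∀ f : S d → ℝ, Measurable f →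
      ∫⁻ x, maximal κ f x ^ p ∂(weightedMeasure τ) ≤
        c * ∫⁻ x, ‖f x‖ₑ ^ p ∂(weightedMeasure τ) := by
  obtain ⟨q, hq1, hqp, hq⟩ := exists_exponent_lt hp hτκ
  have hq0 : 0 < q := by linarith
  have hp0 : 0 ≤ p := by linarith
  obtain ⟨A, -, hA⟩ := exists_maximal_le_absMaximal hκ
  obtain ⟨B, hB⟩ := exists_absMaximal_le_rpow hq1 hq
  obtain ⟨C, hC⟩ := exists_lintegral_absMaximal_rpow_le hτ ((one_lt_div hq0).2 hqp)
  refine ⟨(A * B) ^ p * C, fun f hf => ?_⟩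
  have hpoint : ∀ x, maximal κ f x ^ p ≤
      ((A * B) ^ p : ℝ≥0) * absMaximal τ (fun y => ‖f y‖ₑ ^ q) x ^ (p / q) := fun x =>
    calc maximal κ f x ^ p
        ≤ (A * (B * absMaximal τ (fun y => ‖f y‖ₑ ^ q) x ^ (1 / q))) ^ p :=
          ENNReal.rpow_le_rpow ((hA f x).trans (mul_le_mul_right (hB _ hf.enorm x) _)) hp0
      _ = ((A * B) ^ p : ℝ≥0) * absMaximal τ (fun y => ‖f y‖ₑ ^ q) x ^ (p / q) := by
          rw [← mul_assoc, ENNReal.mul_rpow_of_nonneg _ _ hp0, ← ENNReal.rpow_mul,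
            one_div_mul_eq_div, ENNReal.coe_rpow_of_nonneg _ hp0, ENNReal.coe_mul]
  calc ∫⁻ x, maximal κ f x ^ p ∂(weightedMeasure τ)
      ≤ ((A * B) ^ p : ℝ≥0) *
          ∫⁻ x, absMaximal τ (fun y => ‖f y‖ₑ ^ q) x ^ (p / q) ∂(weightedMeasure τ) :=
        (lintegral_mono hpoint).trans_eq (lintegral_const_mul' _ _ ENNReal.coe_ne_top)
    _ ≤ ((A * B) ^ p : ℝ≥0) *
          (C * ∫⁻ x, (‖f x‖ₑ ^ q) ^ (p / q) ∂(weightedMeasure τ)) :=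
        mul_le_mul_right (hC _ (hf.enorm.pow_const q)) _
    _ = ((A * B) ^ p * C : ℝ≥0) * ∫⁻ x, ‖f x‖ₑ ^ p ∂(weightedMeasure τ) := by
        simp only [← ENNReal.rpow_mul, mul_div_cancel₀ _ hq0.ne']
        rw [ENNReal.coe_mul, mul_assoc]

theorem eLpNorm_top_maximal_le (hκ : ∀ j, 0 ≤ κ j) (f : S d → ℝ) :
    eLpNorm (maximal κ f) ∞ (weightedMeasure τ) ≤ eLpNorm f ∞ (weightedMeasure τ) := by
  rw [eLpNorm_exponent_top, eLpNorm_exponent_top]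
  refine eLpNormEssSup_le_of_ae_enorm_bound (ae_of_all _ fun x => ?_)
  rw [enorm_eq_self]
  exact maximal_le_of_ae_le hκ ((surface_absolutelyContinuous_weightedMeasure τ).ae_le
    (enorm_ae_le_eLpNormEssSup _ _)) x

theorem exists_eLpNorm_maximal_le (hκ : ∀ j, 0 ≤ κ j) (hτ : ∀ j, -(1 / 2 : ℝ) < τ j) {p : ℝ≥0∞}
    (hp : 1 < p) (hτκ : p ≠ ∞ → ∀ j, τ j < p.toReal * κ j + (p.toReal - 1) / 2) :
    ∃ c : ℝ≥0, ∀ f : S d → ℝ, Measurable f →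
      eLpNorm (maximal κ f) p (weightedMeasure τ) ≤ c * eLpNorm f p (weightedMeasure τ) := by
  rcases eq_or_ne p ∞ with rfl | hp'
  · exact ⟨1, fun f _ => (eLpNorm_top_maximal_le hκ f).trans_eq (one_mul _).symm⟩
  have hp0 : p ≠ 0 := (zero_lt_one.trans hp).ne'
  have hp1 : 1 < p.toReal := by
    rwa [← ENNReal.toReal_one, ENNReal.toReal_lt_toReal ENNReal.one_ne_top hp']
  have hinv : 0 ≤ 1 / p.toReal := by positivity
  obtain ⟨c, hc⟩ := exists_lintegral_maximal_rpow_le hκ hτ hp1 (hτκ hp')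
  refine ⟨c ^ (1 / p.toReal), fun f hf => ?_⟩
  simp only [eLpNorm_eq_lintegral_rpow_enorm_toReal hp0 hp', enorm_eq_self]
  rw [ENNReal.coe_rpow_of_nonneg _ hinv, ← ENNReal.mul_rpow_of_nonneg _ _ hinv]
  exact ENNReal.rpow_le_rpow (hc f hf) hinv

end Estimates

end SphereMaximal

end

theorem mainTheorem6 (d : ℕ) (κ τ : Fin (d + 1) → ℝ) (hκ : ∀ j, 0 ≤ κ j)
    (hτ : ∀ j, -(1 / 2 : ℝ) < τ j) :
    -- weak type (1,1)
    ((∀ j, τ j ≤ κ j) →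
      ∃ c : ℝ≥0, ∀ f : SphereMaximal.S d → ℝ,
        MemLp f 1 (SphereMaximal.weightedMeasure τ) →
        ∀ α : ℝ, 0 < α →
          SphereMaximal.weightedMeasure τ
              {x | ENNReal.ofReal α ≤ SphereMaximal.maximal κ f x} ≤
            c * eLpNorm f 1 (SphereMaximal.weightedMeasure τ) / ENNReal.ofReal α) ∧
    -- strong type (p,p), `1 < p ≤ ∞`; for `p = ∞` the upper bound on `τ` is void
    (∀ p : ℝ≥0∞, 1 < p →
      (p ≠ ∞ → ∀ j, τ j < p.toReal * κ j + (p.toReal - 1) / 2) →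
      ∃ c : ℝ≥0, ∀ f : SphereMaximal.S d → ℝ,
        MemLp f p (SphereMaximal.weightedMeasure τ) →
          AEMeasurable (SphereMaximal.maximal κ f) (SphereMaximal.weightedMeasure τ) ∧
          eLpNorm (SphereMaximal.maximal κ f) p (SphereMaximal.weightedMeasure τ) ≤
            c * eLpNorm f p (SphereMaximal.weightedMeasure τ)) ∧
    -- `p = ∞` for continuous functions with the uniform norm
    (∃ c : ℝ≥0, ∀ f : C(SphereMaximal.S d, ℝ),
      (⨆ x, SphereMaximal.maximal κ f x) ≤ c * ‖f‖ₑ) := by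
  refine ⟨fun hτκ => ?_, fun p hp hτκ => ?_, 1, fun f => iSup_le fun x => ?_⟩
  · obtain ⟨c, hc⟩ := SphereMaximal.exists_weightedMeasure_le_maximal_le hκ hτ hτκ
    exact ⟨c, fun f _ => hc f⟩
  · obtain ⟨c, hc⟩ := SphereMaximal.exists_eLpNorm_maximal_le hκ hτ hp hτκ
    refine ⟨c, fun f hf => ?_⟩
    obtain ⟨g, hg, hfg⟩ := hf.aestronglyMeasurable.aemeasurable
    have hsurface := (SphereMaximal.surface_absolutelyContinuous_weightedMeasure τ).ae_le hfg
    rw [SphereMaximal.maximal_congr_ae (κ := κ) hsurface, eLpNorm_congr_ae hfg]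
    exact ⟨(SphereMaximal.measurable_maximal hκ hg).aemeasurable, hc g hg⟩
  · rw [ENNReal.coe_one, one_mul]
    refine SphereMaximal.maximal_le_of_ae_le hκ (Filter.Eventually.of_forall fun y => ?_) x
    rw [enorm_le_iff_norm_le]
    exact f.norm_coe_le_norm y
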